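/- Let $\alpha_1,\alpha_2\in(0,1)$, $\lambda_1,\lambda_2\ge 0$, $c_1,c_2\ge 0$ with $c_1+c_2=1$, and let $S=(S(t))_{t\ge0}$ be a mixture of tempered stable subordinators, i.e. a real Lévy process with $$\mathbb E\,e^{-sS(t)}=\exp\Big(-t\sum_{i=1}^2c_i\big((s+\lambda_i)^{\alpha_i}-\lambda_i^{\alpha_i}\big)\Big),\qquad s>0,\ t\ge 0 .$$ Let $E(t)=\inf\{u>0:S(u)>t\}$ be its inverse. For $\lambda\ge0$, $\nu\in(0,1)$ let $(\lambda+\partial_t)^{\nu}$ be the shifted fractional derivative $$(\lambda+\partial_t)^{\nu}f(t)=\frac{e^{-\lambda t}}{\Gamma(1-\nu)}\int_0^t(t-\tau)^{-\nu}\,\frac{d}{d\tau}\big(e^{\lambda\tau}f(\tau)\big)\,d\tau ,$$ whose Laplace transform is $(\lambda+s)^{\nu}\tilde f(s)-(\lambda+s)^{\nu-1}f(0)$, and let $M^{r}_{p,q}(z)=\sum_{k\ge0}\frac{(r)_k}{\Gamma(pk+q)}\frac{z^k}{k!}$, with $(r)_k=r(r+1)\cdots(r+k-1)$, be the Prabhakar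 function. Then for every $t>0$ the random variable $E(t)$ has a probability density $H(x,t)$ on $x>0$, which can be chosen so that it is differentiable in $x>0$ and $$\partial_xH(x,t)=-\sum_{i=1}^2c_i(\lambda_i+\partial_t)^{\alpha_i}H(x,t)+\sum_{i=1}^2c_i\lambda_i^{\alpha_i}H(x,t)-\sum_{i=1}^2c_i\,t^{-\alpha_i}M^{1-\alpha_i}_{1,1-\alpha_i}(-\lambda_it)\,\delta(x),\qquad H(x,0)=\delta(x),$$ in the following sense. (a) Initial condition: $E(0)=0$ almost surely, $H(x,0)=0$ for $x>0$, and $H(x,t)\,dx\to\delta_0$ weakly as $t\downarrow0$. (b) For all $x>0$, $t>0$ the derivatives exist and the equation holds pointwise, with $\delta(x)=0$. (c) For every $t>0$ the equation holds as an identity of distributions in $x\in[0,\infty)$: for every $\psi\in C_c^\infty(\mathbb R)$, with $\langle H(\cdot,r),\psi\rangle=\mathbb E\,\psi(E(r))$ for $r\ge0$ (so that $\langle H(\cdot,0),\psi\rangle=\psi(0)$), the derivatives below exist, the integral on the left converges absolutely, and $$\int_0^\infty\partial_xH(x,t)\psi(x)\,dx=-\sum_{i=1}^2c_i(\lambda_i+\partial_t)^{\alpha_i}\langle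 H(\cdot,t),\psi\rangle+\sum_{i=1}^2c_i\lambda_i^{\alpha_i}\langle H(\cdot,t),\psi\rangle-\sum_{i=1}^2c_i\,t^{-\alpha_i}M^{1-\alpha_i}_{1,1-\alpha_i}(-\lambda_it)\,\psi(0).$$ Here $\partial_xH$ is the derivative at $x>0$. -/

import Mathlib

open MeasureTheory ProbabilityTheory Filter Topology Set
open scoped NNReal ENNReal

/-- Real-valued Lévy process with time set `[0, ∞)`: it starts at `0`, has independent and
stationary increments, and almost all of its paths are right-continuous with left limits.
(Continuity in probability follows from right-continuity and stationarity.) -/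
structure IsLevyProcess {Ω : Type*} [MeasurableSpace Ω] (S : ℝ≥0 → Ω → ℝ) (P : Measure Ω) :
    Prop where
  measurable : ∀ t, Measurable (S t)
  zero : ∀ᵐ ω ∂P, S 0 ω = 0
  indepIncrements : HasIndepIncrements S P
  stationaryIncrements : ∀ s t : ℝ≥0, IdentDistrib (S (s + t) - S s) (S t) P P
  cadlag : ∀ᵐ ω ∂P, ∀ t : ℝ≥0, ContinuousWithinAt (fun u => S u ω) (Ici t) t ∧
    ∃ l : ℝ, Tendsto (fun u => S u ω) (𝓝[<] t) (𝓝 l)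

/-- The Laplace exponent `∑ i, c i * ((s + lam i) ^ α i - lam i ^ α i)` of the mixture of two
tempered stable subordinators. -/
noncomputable def mtssExponent (c α lam : Fin 2 → ℝ) (s : ℝ) : ℝ :=
  ∑ i, c i * ((s + lam i) ^ α i - lam i ^ α i)

/-- Mixture of tempered stable subordinators: a Lévy process `S` whose Laplace transform is
`E[exp (-s S(t))] = exp (-t φ(s))`, `s > 0`, with `φ = mtssExponent c α lam`. -/
structure IsMTSS {Ω : Type*} [MeasurableSpace Ω] (c α lam : Fin 2 → ℝ) (S : ℝ≥0 → Ω → ℝ)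
    (P : Measure Ω) : Prop extends IsLevyProcess S P where
  laplace : ∀ (t : ℝ≥0) (s : ℝ), 0 < s →
    ∫ ω, Real.exp (-s * S t ω) ∂P = Real.exp (-t * mtssExponent c α lam s)

/-- The right-continuous inverse (first exit time) `E(t) = inf {u > 0 : S(u) > t}`, as a real
random variable. -/
noncomputable def firstExit {Ω : Type*} (S : ℝ≥0 → Ω → ℝ) (t : ℝ) (ω : Ω) : ℝ :=
  ((sInf {u : ℝ≥0 | 0 < u ∧ t < S u ω} : ℝ≥0) : ℝ)

/-- The generalized (Prabhakar) Mittag-Leffler function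
`M^r_{p,q}(z) = ∑ k, (r)_k / Γ(p k + q) * z ^ k / k!`, where `(r)_k = r (r+1) ⋯ (r+k-1)`. -/
noncomputable def prabhakar (p q r z : ℝ) : ℝ :=
  ∑' k : ℕ, (ascPochhammer ℝ k).eval r / Real.Gamma (p * k + q) * (z ^ k / (k.factorial : ℝ))

/-- The shifted fractional derivative `(a + d/dt)^ν f (t)` of order `ν ∈ (0,1)`, the operator
whose Laplace transform is `(a + s)^ν F(s) - (a + s)^(ν - 1) f(0)`, where `F` is that of `f`: the conjugate of the
fractional derivative
`D^ν g (t) = (1 / Γ(1 - ν)) ∫₀ᵗ (t - τ)^(-ν) g'(τ) dτ` by the exponential `exp (a t)`. -/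
noncomputable def shiftedFracDeriv (a ν : ℝ) (f : ℝ → ℝ) (t : ℝ) : ℝ :=
  Real.exp (-a * t) * ((Real.Gamma (1 - ν))⁻¹ *
    ∫ τ in (0 : ℝ)..t, (t - τ) ^ (-ν) * deriv (fun r => Real.exp (a * r) * f r) τ)

/-- `(a + d/dt)^ν f (t)` exists, in the sense that the formula in `shiftedFracDeriv` has its
genuine meaning: `f` is continuous on `[0, t]` (so that its initial value is `f 0`) and
differentiable on `(0, t)` with integrable derivative, and the singular integral converges
absolutely. -/
def HasShiftedFracDeriv (a ν : ℝ) (f : ℝ → ℝ) (t : ℝ) : Prop :=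
  ContinuousOn f (Icc 0 t) ∧
  (∀ τ ∈ Ioo 0 t, DifferentiableAt ℝ f τ) ∧
  IntervalIntegrable (deriv f) volume 0 t ∧
  IntervalIntegrable
    (fun τ => (t - τ) ^ (-ν) * deriv (fun r => Real.exp (a * r) * f r) τ) volume 0 t

/-!
Write `φ` for the Laplace exponent, extended to `Re z > 0`. There `Re φ` grows like a positive
power of `|z|` along vertical lines, so for every `x > 0` and every symbol `Q` of polynomial growth
the Bromwich integral

  `B_Q(x, t) = (1 / 2πi) ∫ e^{z t} Q(z) e^{-x φ(z)} dz`   over the line `Re z = 1`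

converges absolutely, is differentiable in `x > 0` and `t`, and `∂_x`, `∂_t` multiply the symbol by
`-φ(z)` and `z`. Everything is expressed through such integrals. The survival function is
`P(E(t) > x) = P(S(x) ≤ t) = B_{1/z}(x, t)` by Fourier inversion (`measureReal_le_eq`); the first
equality uses that almost all paths of `S` are nondecreasing and unbounded and that `S(x)` has no
atoms. The law of `S(x)` has the density `B_1`, and `H = -∂_x B_{1/z} = B_{φ/z}` is the density of
`E(t)` (`hasLaw_firstExit`).

Pointwise equation. If `B_Q(x, ·)` vanishes on the negative half-line, then `(a + ∂_t)^ν B_Q` is a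
convolution over the whole half-line, and the Gamma integral
`∫_0^∞ v^{-ν} e^{-(z + a) v} dv = Γ(1 - ν) (z + a)^{ν - 1}` shows that the operator multiplies the
symbol by `(z + a)^ν`. Hence `∑ i, c i (λ_i + ∂_t)^{α_i} - ∑ i, c i λ_i^{α_i}` multiplies symbols by
`φ`, that is, acts as `-∂_x` (`sum_shiftedFracDeriv_bromwich`). `B_{1/z}` and `H` both vanish for
negative times because `S ≥ 0`.

Equation on test functions. Since `E ψ(E(r)) = ψ(0) + ∫ ψ'(x) P(E(r) > x) dx`, the equation for
the survival function, integrated against `ψ'`, gives `∫ ψ' H`, and an integration by parts turns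
this into `-∫ ψ ∂_x H` minus the boundary term `ψ(0) H(0+, t)`. As `x ↓ 0` the survival function
tends to `1` for positive times but stays `0` at time `0`, so `(λ + ∂_t)^α` of it tends to
`(λ + ∂_t)^α 1` plus the contribution `t^{-α} e^{-λ t} / Γ(1 - α)` of the jump
(`tendsto_shiftedFracDeriv_survival`). In `ψ(0) H(0+, t)` the terms `(λ_i + ∂_t)^{α_i} 1` and
`λ_i^{α_i}` are cancelled by those of the constant `ψ(0)` in the formula for `E ψ(E(r))`; the jumps
remain and are the Prabhakar terms, because `M^r_{1,r}(z) = e^z / Γ(r)` (`prabhakar_one_self`).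

Interchanging the limits and integrals requires bounds near `x = 0`, where `e^{-x φ(z)}` no longer
helps. They come from integrating by parts along the line: `t B_Q` is the Bromwich integral with
symbol `-(Q' - x φ' Q)`, and each step gains a factor `1 / |z|`. Two steps show that the density
of `S(x)` is `O(x)` away from `t = 0` (`exists_subordinatorDensity_le`), and one shows that
`∂_x H` has an integrable singularity at `x = 0` (`exists_abs_deriv_exitDensity_le`).
-/

/-! ### The Laplace exponent on the vertical line `Re z = 1` -/

/-- The standing assumptions on the parameters of the mixture. -/
structure IsMixture (c α lam : Fin 2 → ℝ) : Prop where
  c_nonneg : ∀ i, 0 ≤ c i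
  c_sum : ∑ i, c i = 1
  α_mem : ∀ i, α i ∈ Ioo (0 : ℝ) 1
  lam_nonneg : ∀ i, 0 ≤ lam i

/-- The Laplace exponent `mtssExponent` as a function of a complex variable. -/
noncomputable def laplaceExp (c α lam : Fin 2 → ℝ) (z : ℂ) : ℂ :=
  ∑ i, (c i : ℂ) * ((z + lam i) ^ (α i : ℂ) - ((lam i ^ α i : ℝ) : ℂ))

/-- The vertical line `w ↦ 1 + 2 π i w` along which Laplace transforms are inverted. With this
parametrization the inversion formula is Mathlib's inverse Fourier transform, with no constant in
front of the integral. -/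
noncomputable def vline (w : ℝ) : ℂ := 1 + ((2 * Real.pi * w : ℝ) : ℂ) * Complex.I

/-- The growth rate `∑ i, c i * |z + lam i| ^ α i` of the Laplace exponent on the line. -/
noncomputable def growth (c α lam : Fin 2 → ℝ) (w : ℝ) : ℝ :=
  ∑ i, c i * ‖vline w + lam i‖ ^ α i

@[simp] lemma vline_re (w : ℝ) : (vline w).re = 1 := by simp [vline]

@[simp] lemma vline_im (w : ℝ) : (vline w).im = 2 * Real.pi * w := by simp [vline]

lemma continuous_vline : Continuous vline := by unfold vline; fun_prop

lemma hasDerivAt_vline (w : ℝ) : HasDerivAt vline (2 * Real.pi * Complex.I) w := by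
  have h : HasDerivAt (fun w : ℝ => 2 * Real.pi * w) (2 * Real.pi) w := by
    simpa using (hasDerivAt_id w).const_mul (2 * Real.pi)
  have := (h.ofReal_comp.mul_const Complex.I).const_add 1
  refine this.congr_deriv ?_
  push_cast
  ring

lemma one_le_norm_vline (w : ℝ) : 1 ≤ ‖vline w‖ := by
  have := Complex.abs_re_le_norm (vline w)
  simpa using this

lemma vline_ne_zero (w : ℝ) : vline w ≠ 0 := by
  intro h
  have := one_le_norm_vline w
  rw [h, norm_zero] at this
  linarith

lemma abs_le_norm_vline (w : ℝ) : |w| ≤ ‖vline w‖ := by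
  have := Complex.abs_im_le_norm (vline w)
  rw [vline_im, abs_mul, abs_of_pos (by positivity : 0 < 2 * Real.pi)] at this
  have h3 := Real.pi_gt_three
  nlinarith [abs_nonneg w]

lemma norm_vline_le (w : ℝ) : ‖vline w‖ ≤ 8 * (1 + |w|) := by
  have h1 : ‖vline w‖ ≤ 1 + 2 * Real.pi * |w| := by
    unfold vline
    refine (norm_add_le _ _).trans ?_
    rw [norm_mul, Complex.norm_real, Complex.norm_I, Real.norm_eq_abs, abs_mul,
      abs_of_pos (by positivity : 0 < 2 * Real.pi)]
    simp
  nlinarith [abs_nonneg w, Real.pi_lt_four]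

lemma norm_vline_le_add (w : ℝ) {l : ℝ} (hl : 0 ≤ l) : ‖vline w‖ ≤ ‖vline w + l‖ := by
  rw [Complex.norm_def, Complex.norm_def]
  apply Real.sqrt_le_sqrt
  simp only [Complex.normSq_apply, Complex.add_re, Complex.add_im, vline_re, vline_im,
    Complex.ofReal_re, Complex.ofReal_im]
  nlinarith

lemma one_le_norm_vline_add (w : ℝ) {l : ℝ} (hl : 0 ≤ l) : 1 ≤ ‖vline w + l‖ :=
  (one_le_norm_vline w).trans (norm_vline_le_add w hl)

lemma norm_vline_add_le (w : ℝ) {l : ℝ} (hl : 0 ≤ l) :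
    ‖vline w + l‖ ≤ (1 + l) * ‖vline w‖ := by
  refine (norm_add_le _ _).trans ?_
  rw [Complex.norm_real, Real.norm_eq_abs, abs_of_nonneg hl]
  nlinarith [one_le_norm_vline w]

lemma vline_add_mem_slitPlane (w : ℝ) {l : ℝ} (hl : 0 ≤ l) :
    vline w + l ∈ Complex.slitPlane := by
  left
  simp only [Complex.add_re, vline_re, Complex.ofReal_re]
  linarith

lemma cos_mul_norm_rpow_le_re_cpow {z : ℂ} (hz : 0 < z.re) {a : ℝ} (ha0 : 0 ≤ a) (ha1 : a ≤ 1) :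
    Real.cos (Real.pi / 2 * a) * ‖z‖ ^ a ≤ (z ^ (a : ℂ)).re := by
  have hz0 : z ≠ 0 := by rintro rfl; simp at hz
  have hn : 0 < ‖z‖ := norm_pos_iff.2 hz0
  rw [Complex.cpow_def_of_ne_zero hz0, Complex.exp_re]
  have h1 : (Complex.log z * a).re = Real.log ‖z‖ * a := by
    simp [Complex.log_re]
  have h2 : (Complex.log z * a).im = Complex.arg z * a := by
    simp [Complex.log_im]
  rw [h1, h2, ← Real.rpow_def_of_pos hn, mul_comm]
  gcongr
  have harg : |Complex.arg z| < Real.pi / 2 := Complex.abs_arg_lt_pi_div_two_iff.2 (Or.inl hz)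
  rw [← Real.cos_abs (Complex.arg z * a), abs_mul, abs_of_nonneg ha0]
  apply Real.cos_le_cos_of_nonneg_of_le_pi
  · positivity
  · nlinarith [Real.pi_pos]
  · exact mul_le_mul_of_nonneg_right harg.le ha0

namespace IsMixture

variable {c α lam : Fin 2 → ℝ}

/-- The constant `∑ i, c i * lam i ^ α i` in the Laplace exponent. -/
noncomputable def killing (c α lam : Fin 2 → ℝ) : ℝ := ∑ i, c i * lam i ^ α i

lemma killing_nonneg (h : IsMixture c α lam) : 0 ≤ killing c α lam :=
  Finset.sum_nonneg fun i _ => mul_nonneg (h.c_nonneg i) (Real.rpow_nonneg (h.lam_nonneg i) _)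

lemma laplaceExp_eq (c α lam : Fin 2 → ℝ) (z : ℂ) :
    laplaceExp c α lam z = ∑ i, (c i : ℂ) * (z + lam i) ^ (α i : ℂ) - killing c α lam := by
  simp only [laplaceExp, killing, mul_sub, Finset.sum_sub_distrib]
  push_cast
  rfl

lemma one_le_growth (h : IsMixture c α lam) (w : ℝ) : 1 ≤ growth c α lam w := by
  unfold growth
  rw [← h.c_sum]
  refine Finset.sum_le_sum fun i _ => ?_
  have := Real.one_le_rpow (one_le_norm_vline_add w (h.lam_nonneg i)) (h.α_mem i).1.le
  nlinarith [h.c_nonneg i]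

lemma norm_laplaceExp_le (h : IsMixture c α lam) (w : ℝ) :
    ‖laplaceExp c α lam (vline w)‖ ≤ (1 + killing c α lam) * growth c α lam w := by
  have h1 : ‖laplaceExp c α lam (vline w)‖ ≤ growth c α lam w + killing c α lam := by
    rw [laplaceExp_eq]
    refine (norm_sub_le _ _).trans (add_le_add ?_ ?_)
    · refine (norm_sum_le _ _).trans (Finset.sum_le_sum fun i _ => ?_)
      rw [norm_mul, Complex.norm_real, Real.norm_eq_abs, abs_of_nonneg (h.c_nonneg i),
        Complex.norm_cpow_real]
    · rw [Complex.norm_real, Real.norm_eq_abs, abs_of_nonneg h.killing_nonneg]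
  nlinarith [h.one_le_growth w, h.killing_nonneg]

lemma exists_re_laplaceExp_ge (h : IsMixture c α lam) :
    ∃ k > 0, ∀ w, k * growth c α lam w - killing c α lam ≤ (laplaceExp c α lam (vline w)).re := by
  have hcos : ∀ i, 0 < Real.cos (Real.pi / 2 * α i) := fun i => by
    apply Real.cos_pos_of_mem_Ioo
    have := h.α_mem i
    constructor <;> nlinarith [Real.pi_pos, this.1, this.2]
  refine ⟨min (Real.cos (Real.pi / 2 * α 0)) (Real.cos (Real.pi / 2 * α 1)),
    lt_min (hcos 0) (hcos 1), fun w => ?_⟩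
  rw [laplaceExp_eq, Complex.sub_re, Complex.ofReal_re, Complex.re_sum]
  gcongr
  unfold growth
  rw [Finset.mul_sum]
  refine Finset.sum_le_sum fun i _ => ?_
  rw [Complex.re_ofReal_mul, mul_left_comm]
  refine mul_le_mul_of_nonneg_left ?_ (h.c_nonneg i)
  refine le_trans ?_ (cos_mul_norm_rpow_le_re_cpow ?_ (h.α_mem i).1.le (h.α_mem i).2.le)
  · refine mul_le_mul_of_nonneg_right ?_ (by positivity)
    fin_cases i
    · exact min_le_left _ _
    · exact min_le_right _ _
  · have := h.lam_nonneg i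
    simp only [Complex.add_re, vline_re, Complex.ofReal_re]
    linarith

lemma exists_growth_ge (h : IsMixture c α lam) :
    ∃ κ > 0, ∃ β ∈ Ioo (0 : ℝ) 1, ∀ w, κ * |w| ^ β ≤ growth c α lam w := by
  obtain ⟨i, hi⟩ : ∃ i, 0 < c i := by
    by_contra! hcon
    have : ∑ i, c i ≤ 0 := Finset.sum_nonpos fun i _ => hcon i
    linarith [h.c_sum]
  refine ⟨c i, hi, α i, h.α_mem i, fun w => ?_⟩
  unfold growth
  refine le_trans ?_ (Finset.single_le_sum (f := fun i => c i * ‖vline w + lam i‖ ^ α i)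
    (fun j _ => mul_nonneg (h.c_nonneg j) (by positivity)) (Finset.mem_univ i))
  gcongr
  · exact (h.α_mem i).1.le
  · exact (abs_le_norm_vline w).trans (norm_vline_le_add w (h.lam_nonneg i))

lemma exists_growth_le (h : IsMixture c α lam) :
    ∃ C > 0, ∃ a ∈ Ioo (0 : ℝ) 1, ∀ w, growth c α lam w ≤ C * ‖vline w‖ ^ a := by
  refine ⟨(1 + lam 0) * (1 + lam 1), ?_, max (α 0) (α 1), ⟨lt_max_of_lt_left (h.α_mem 0).1,
    max_lt (h.α_mem 0).2 (h.α_mem 1).2⟩, fun w => ?_⟩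
  · have := h.lam_nonneg 0
    have := h.lam_nonneg 1
    positivity
  unfold growth
  calc ∑ i, c i * ‖vline w + lam i‖ ^ α i
      ≤ ∑ i, c i * ((1 + lam 0) * (1 + lam 1) * ‖vline w‖ ^ max (α 0) (α 1)) := by
        refine Finset.sum_le_sum fun i _ => mul_le_mul_of_nonneg_left ?_ (h.c_nonneg i)
        have h1 := norm_vline_add_le w (h.lam_nonneg i)
        have hl0 := h.lam_nonneg 0
        have hl1 := h.lam_nonneg 1
        have hli := h.lam_nonneg i
        calc ‖vline w + lam i‖ ^ α i ≤ ((1 + lam i) * ‖vline w‖) ^ α i := by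
              gcongr; exact (h.α_mem i).1.le
          _ = (1 + lam i) ^ α i * ‖vline w‖ ^ α i := by
              rw [Real.mul_rpow (by linarith) (norm_nonneg _)]
          _ ≤ ((1 + lam 0) * (1 + lam 1)) * ‖vline w‖ ^ max (α 0) (α 1) := by
              gcongr ?_ * ?_
              · calc (1 + lam i) ^ α i ≤ (1 + lam i) ^ (1 : ℝ) :=
                    Real.rpow_le_rpow_of_exponent_le (by linarith) (h.α_mem i).2.le
                  _ ≤ _ := by
                    rw [Real.rpow_one]
                    fin_cases i
                    · show 1 + lam 0 ≤ _; nlinarith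
                    · show 1 + lam 1 ≤ _; nlinarith
              · refine Real.rpow_le_rpow_of_exponent_le (one_le_norm_vline w) ?_
                fin_cases i
                · exact le_max_left _ _
                · exact le_max_right _ _
    _ = _ := by rw [← Finset.sum_mul, h.c_sum, one_mul]

lemma differentiableAt_laplaceExp (h : IsMixture c α lam) {z : ℂ} (hz : 0 < z.re) :
    HasDerivAt (laplaceExp c α lam) (∑ i, (c i : ℂ) * (α i * (z + lam i) ^ ((α i : ℂ) - 1))) z := by
  unfold laplaceExp
  refine HasDerivAt.fun_sum fun i _ => ?_
  refine HasDerivAt.const_mul _ (HasDerivAt.sub_const _ ?_)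
  have h1 : HasDerivAt (fun z : ℂ => z + lam i) 1 z := (hasDerivAt_id z).add_const _
  have h2 : z + lam i ∈ Complex.slitPlane := by
    left
    have := h.lam_nonneg i
    simp only [Complex.add_re, Complex.ofReal_re]
    linarith
  simpa using h1.cpow_const (c := (α i : ℂ)) h2

lemma continuous_laplaceExp_vline (h : IsMixture c α lam) :
    Continuous fun w => laplaceExp c α lam (vline w) := by
  refine continuous_iff_continuousAt.2 fun w => ?_
  exact ((h.differentiableAt_laplaceExp (z := vline w) (by simp)).continuousAt).comp
    continuous_vline.continuousAt

lemma laplaceExp_ofReal (h : IsMixture c α lam) {s : ℝ} (hs : 0 < s) :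
    laplaceExp c α lam s = mtssExponent c α lam s := by
  unfold laplaceExp mtssExponent
  rw [Complex.ofReal_sum]
  refine Finset.sum_congr rfl fun i _ => ?_
  have h0 : 0 ≤ s + lam i := by linarith [h.lam_nonneg i]
  rw [Complex.ofReal_mul, Complex.ofReal_sub, Complex.ofReal_cpow h0, Complex.ofReal_add]

end IsMixture

/-! ### Bromwich integrals -/

lemma integrable_comp_abs_of_integrableOn_Ioi {f : ℝ → ℝ} (hf : IntegrableOn f (Ioi 0)) :
    Integrable fun w => f |w| := by
  have h0 : IntegrableOn (fun w => f |w|) (Ioi 0) :=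
    hf.congr_fun (fun x hx => by rw [abs_of_pos hx]) measurableSet_Ioi
  have h1 : IntegrableOn (fun w ↦ f |w|) (Iic 0) := by
    rw [← Measure.map_neg_eq_self (volume : Measure ℝ)]
    let m : MeasurableEmbedding fun x : ℝ => -x := (Homeomorph.neg ℝ).measurableEmbedding
    rw [m.integrableOn_map_iff]
    simp_rw [Function.comp_def, abs_neg, neg_preimage, neg_Iic, neg_zero]
    exact Iff.mpr integrableOn_Ici_iff_integrableOn_Ioi h0
  rw [← integrableOn_univ, ← Iic_union_Ioi (a := (0 : ℝ))]
  exact h1.union h0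

lemma integrable_one_add_abs_pow_mul_exp {b β : ℝ} (hb : 0 < b) (hβ : 0 < β) (n : ℕ) :
    Integrable fun w : ℝ => (1 + |w|) ^ n * Real.exp (-b * |w| ^ β) := by
  have key : IntegrableOn (fun w : ℝ => 2 ^ n * (w ^ (0 : ℝ) * Real.exp (-b * w ^ β))
      + 2 ^ n * (w ^ (n : ℝ) * Real.exp (-b * w ^ β))) (Ioi 0) :=
    ((integrableOn_rpow_mul_exp_neg_mul_rpow (by norm_num) hβ hb).const_mul _).add
    ((integrableOn_rpow_mul_exp_neg_mul_rpow
      (by have : (0 : ℝ) ≤ n := by positivity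
          linarith) hβ hb).const_mul _)
  refine (integrable_comp_abs_of_integrableOn_Ioi key).mono' ?_ (ae_of_all _ fun w => ?_)
  · have h1 : Continuous fun w : ℝ => |w| ^ β :=
      continuous_abs.rpow_const fun w => Or.inr hβ.le
    exact (((continuous_const.add continuous_abs).pow n).mul
      (Real.continuous_exp.comp (continuous_const.mul h1))).aestronglyMeasurable
  · rw [Real.norm_of_nonneg (by positivity), Real.rpow_zero, Real.rpow_natCast, one_mul,
      ← mul_assoc,
      ← add_mul]
    gcongr
    rcases le_total |w| 1 with hw | hw
    · calc (1 + |w|) ^ n ≤ (1 + 1) ^ n := by gcongr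
        _ ≤ _ := by norm_num
    · calc (1 + |w|) ^ n ≤ (|w| + |w|) ^ n := by gcongr
        _ = 2 ^ n * |w| ^ n := by rw [← two_mul, mul_pow]
        _ ≤ _ := by simp

/-- Continuous functions of polynomial growth on the line; these are the symbols `Q` for which the
Bromwich integrals converge. -/
structure PolyGrowth (Q : ℝ → ℂ) : Prop where
  cont : Continuous Q
  bound : ∃ C : ℝ, ∃ n : ℕ, ∀ w, ‖Q w‖ ≤ C * (1 + |w|) ^ n

namespace PolyGrowth

lemma const (a : ℂ) : PolyGrowth fun _ => a := ⟨continuous_const, ‖a‖, 0, fun w => by simp⟩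

lemma mul {Q R : ℝ → ℂ} (hQ : PolyGrowth Q) (hR : PolyGrowth R) :
    PolyGrowth fun w => Q w * R w := by
  obtain ⟨C, n, hC⟩ := hQ.bound
  obtain ⟨D, m, hD⟩ := hR.bound
  refine ⟨hQ.cont.mul hR.cont, C * D, n + m, fun w => ?_⟩
  rw [norm_mul, pow_add, mul_mul_mul_comm]
  have h1 := hC w
  exact mul_le_mul h1 (hD w) (norm_nonneg _) ((norm_nonneg _).trans h1)

lemma add {Q R : ℝ → ℂ} (hQ : PolyGrowth Q) (hR : PolyGrowth R) :
    PolyGrowth fun w => Q w + R w := by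
  obtain ⟨C, n, hC⟩ := hQ.bound
  obtain ⟨D, m, hD⟩ := hR.bound
  refine ⟨hQ.cont.add hR.cont, |C| + |D|, max n m, fun w => ?_⟩
  have h1 : 1 ≤ 1 + |w| := by linarith [abs_nonneg w]
  calc ‖Q w + R w‖ ≤ ‖Q w‖ + ‖R w‖ := norm_add_le _ _
    _ ≤ C * (1 + |w|) ^ n + D * (1 + |w|) ^ m := add_le_add (hC w) (hD w)
    _ ≤ |C| * (1 + |w|) ^ max n m + |D| * (1 + |w|) ^ max n m := by
        gcongr
        · exact le_abs_self C
        · exact le_max_left _ _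
        · exact le_abs_self D
        · exact le_max_right _ _
    _ = _ := by ring

lemma neg {Q : ℝ → ℂ} (hQ : PolyGrowth Q) : PolyGrowth fun w => -Q w := by
  simpa using (const (-1)).mul hQ

lemma vline : PolyGrowth vline :=
  ⟨continuous_vline, 8, 1, fun w => by simpa using norm_vline_le w⟩

lemma vline_add_cpow {l : ℝ} (hl : 0 ≤ l) {ν : ℝ} (hν : ν ≤ 1) :
    PolyGrowth fun w => (_root_.vline w + l) ^ (ν : ℂ) := by
  refine ⟨?_, (1 + l) * 8, 1, fun w => ?_⟩
  · exact (continuous_vline.add continuous_const).cpow continuous_const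
      fun w => vline_add_mem_slitPlane w hl
  · rw [Complex.norm_cpow_real, pow_one]
    calc ‖_root_.vline w + l‖ ^ ν ≤ ‖_root_.vline w + l‖ ^ (1 : ℝ) :=
          Real.rpow_le_rpow_of_exponent_le (one_le_norm_vline_add w hl) hν
      _ ≤ (1 + l) * ‖_root_.vline w‖ := by rw [Real.rpow_one]; exact norm_vline_add_le w hl
      _ ≤ (1 + l) * (8 * (1 + |w|)) := by gcongr; exact norm_vline_le w
      _ = _ := by ring

lemma vline_inv : PolyGrowth fun w => (_root_.vline w)⁻¹ := by
  refine ⟨continuous_vline.inv₀ vline_ne_zero, 1, 0, fun w => ?_⟩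
  rw [norm_inv]
  simpa using inv_le_one_of_one_le₀ (one_le_norm_vline w)

lemma laplaceExp {c α lam : Fin 2 → ℝ} (h : IsMixture c α lam) :
    PolyGrowth fun w => laplaceExp c α lam (_root_.vline w) := by
  simp_rw [IsMixture.laplaceExp_eq]
  simp only [Fin.sum_univ_two, sub_eq_add_neg]
  exact ((((const _).mul (vline_add_cpow (h.lam_nonneg 0) (h.α_mem 0).2.le)).add
    ((const _).mul (vline_add_cpow (h.lam_nonneg 1) (h.α_mem 1).2.le))).add (const _))

end PolyGrowth

/-- The integrand `e^{z t} Q e^{-x φ(z)}`, `z = vline w`, of the Bromwich integral. -/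
noncomputable def bromwichKernel (c α lam : Fin 2 → ℝ) (Q : ℝ → ℂ) (x t w : ℝ) : ℂ :=
  Complex.exp (vline w * t) * Q w * Complex.exp (-(x * laplaceExp c α lam (vline w)))

/-- The real part of the Bromwich integral
`(1 / 2πi) ∫ e^{z t} Q(z) e^{-x φ(z)} dz` over the line `Re z = 1`: the inverse Laplace transform
in `t` of `Q(s) e^{-x φ(s)}`. -/
noncomputable def bromwich (c α lam : Fin 2 → ℝ) (Q : ℝ → ℂ) (x t : ℝ) : ℝ :=
  (∫ w, bromwichKernel c α lam Q x t w).re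

section Bromwich

variable {c α lam : Fin 2 → ℝ} {Q : ℝ → ℂ}

lemma norm_bromwichKernel (c α lam : Fin 2 → ℝ) (Q : ℝ → ℂ) (x t w : ℝ) :
    ‖bromwichKernel c α lam Q x t w‖ =
      Real.exp t * ‖Q w‖ * Real.exp (-(x * (laplaceExp c α lam (vline w)).re)) := by
  simp [bromwichKernel, Complex.norm_exp]

/-- A dominating function for the Bromwich integrand that is uniform for `x` and `t` in bounded
sets, `x` away from `0`. -/
lemma exists_bromwich_bound (h : IsMixture c α lam) (hQ : PolyGrowth Q) {x₀ : ℝ} (hx₀ : 0 < x₀)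
    (X T : ℝ) : ∃ g : ℝ → ℝ, Integrable g ∧ ∀ x t w, x₀ ≤ x → x ≤ X → t ≤ T →
      ‖bromwichKernel c α lam Q x t w‖ ≤ g w := by
  obtain ⟨k, hk, hre⟩ := h.exists_re_laplaceExp_ge
  obtain ⟨κ, hκ, β, hβ, hgr⟩ := h.exists_growth_ge
  obtain ⟨C, n, hC⟩ := hQ.bound
  refine ⟨fun w => Real.exp T * |C| * Real.exp (X * IsMixture.killing c α lam) *
    ((1 + |w|) ^ n * Real.exp (-(x₀ * k * κ) * |w| ^ β)), ?_, fun x t w h1 h2 h3 => ?_⟩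
  · exact (integrable_one_add_abs_pow_mul_exp (by positivity) hβ.1 n).const_mul _
  · rw [norm_bromwichKernel]
    have hx : 0 < x := hx₀.trans_le h1
    have e1 : -(x * (laplaceExp c α lam (vline w)).re)
        ≤ X * IsMixture.killing c α lam + -(x₀ * k * κ) * |w| ^ β := by
      have a1 := hre w
      have a2 := hgr w
      have a3 : 0 ≤ |w| ^ β := by positivity
      have a4 := h.killing_nonneg
      have a5 : x * (k * (κ * |w| ^ β) - IsMixture.killing c α lam)
          ≤ x * (laplaceExp c α lam (vline w)).re := by
        apply mul_le_mul_of_nonneg_left _ hx.le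
        nlinarith
      have a6 : x₀ * (k * (κ * |w| ^ β)) ≤ x * (k * (κ * |w| ^ β)) := by gcongr
      nlinarith
    calc Real.exp t * ‖Q w‖ * Real.exp (-(x * (laplaceExp c α lam (vline w)).re))
        ≤ Real.exp T * (|C| * (1 + |w|) ^ n) *
          Real.exp (X * IsMixture.killing c α lam + -(x₀ * k * κ) * |w| ^ β) := by
          gcongr
          refine (hC w).trans ?_
          gcongr
          exact le_abs_self C
      _ = _ := by rw [Real.exp_add]; ring

lemma continuous_bromwichKernel (h : IsMixture c α lam) (hQ : PolyGrowth Q) :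
    Continuous fun p : ℝ × ℝ × ℝ => bromwichKernel c α lam Q p.1 p.2.1 p.2.2 := by
  unfold bromwichKernel
  have h1 : Continuous fun p : ℝ × ℝ × ℝ => vline p.2.2 :=
    continuous_vline.comp (continuous_snd.comp continuous_snd)
  have h2 : Continuous fun p : ℝ × ℝ × ℝ => Q p.2.2 :=
    hQ.cont.comp (continuous_snd.comp continuous_snd)
  have h3 : Continuous fun p : ℝ × ℝ × ℝ => laplaceExp c α lam (vline p.2.2) :=
    h.continuous_laplaceExp_vline.comp (continuous_snd.comp continuous_snd)
  have h4 : Continuous fun p : ℝ × ℝ × ℝ => (p.1 : ℂ) :=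
    Complex.continuous_ofReal.comp continuous_fst
  have h5 : Continuous fun p : ℝ × ℝ × ℝ => (p.2.1 : ℂ) :=
    Complex.continuous_ofReal.comp (continuous_fst.comp continuous_snd)
  exact ((h1.mul h5).cexp.mul h2).mul (h4.mul h3).neg.cexp

lemma continuous_bromwichKernel_right (h : IsMixture c α lam) (hQ : PolyGrowth Q) (x t : ℝ) :
    Continuous fun w => bromwichKernel c α lam Q x t w :=
  (continuous_bromwichKernel h hQ).comp
    (f := fun w : ℝ => (x, t, w)) (by fun_prop)

lemma integrable_bromwichKernel (h : IsMixture c α lam) (hQ : PolyGrowth Q) {x : ℝ} (hx : 0 < x)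
    (t : ℝ) : Integrable fun w => bromwichKernel c α lam Q x t w := by
  obtain ⟨g, hg, hb⟩ := exists_bromwich_bound h hQ hx x t
  exact hg.mono' (continuous_bromwichKernel_right h hQ x t).aestronglyMeasurable
    (ae_of_all _ fun w => hb x t w le_rfl le_rfl le_rfl)

lemma bromwich_add (h : IsMixture c α lam) {R : ℝ → ℂ} (hQ : PolyGrowth Q) (hR : PolyGrowth R)
    {x : ℝ} (hx : 0 < x) (t : ℝ) :
    bromwich c α lam (fun w => Q w + R w) x t =
      bromwich c α lam Q x t + bromwich c α lam R x t := by
  unfold bromwich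
  rw [← Complex.add_re, ← integral_add (integrable_bromwichKernel h hQ hx t)
    (integrable_bromwichKernel h hR hx t)]
  congr 2
  ext w
  simp only [bromwichKernel]
  ring

lemma bromwich_real_mul (a : ℝ) (Q : ℝ → ℂ) (x t : ℝ) :
    bromwich c α lam (fun w => a * Q w) x t = a * bromwich c α lam Q x t := by
  unfold bromwich
  rw [← Complex.re_ofReal_mul, ← integral_const_mul]
  congr 2
  ext w
  simp only [bromwichKernel]
  ring

lemma hasDerivAt_bromwich_right (h : IsMixture c α lam) (hQ : PolyGrowth Q) {x : ℝ} (hx : 0 < x)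
    (t : ℝ) : HasDerivAt (fun t => bromwich c α lam Q x t)
      (bromwich c α lam (fun w => vline w * Q w) x t) t := by
  obtain ⟨g, hg, hb⟩ := exists_bromwich_bound h (PolyGrowth.vline.mul hQ) hx x (t + 1)
  have key := (hasDerivAt_integral_of_dominated_loc_of_deriv_le (μ := volume) (𝕜 := ℝ)
    (F := fun t w => bromwichKernel c α lam Q x t w)
    (F' := fun t w => bromwichKernel c α lam (fun w => vline w * Q w) x t w)
    (bound := g) (s := Iio (t + 1)) (x₀ := t) (Iio_mem_nhds (by linarith))
    (Eventually.of_forall fun t =>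
      (continuous_bromwichKernel_right h hQ x t).aestronglyMeasurable)
    (integrable_bromwichKernel h hQ hx t)
    (continuous_bromwichKernel_right h (PolyGrowth.vline.mul hQ) x t).aestronglyMeasurable
    (ae_of_all _ fun w s hs => hb x s w le_rfl le_rfl (le_of_lt hs)) hg
    (ae_of_all _ fun w s _ => ?_)).2
  · exact Complex.reCLM.hasFDerivAt.comp_hasDerivAt t key
  · have h1 : HasDerivAt (fun s : ℝ => vline w * s) (vline w) s := by
      simpa using (Complex.ofRealCLM.hasDerivAt (x := s)).const_mul (vline w)
    have := (h1.cexp.mul_const (Q w)).mul_const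
      (Complex.exp (-(x * laplaceExp c α lam (vline w))))
    refine this.congr_deriv ?_
    simp only [bromwichKernel]
    ring

lemma hasDerivAt_bromwich_left (h : IsMixture c α lam) (hQ : PolyGrowth Q) {x : ℝ} (hx : 0 < x)
    (t : ℝ) : HasDerivAt (fun x => bromwich c α lam Q x t)
      (bromwich c α lam (fun w => -laplaceExp c α lam (vline w) * Q w) x t) x := by
  have hQ' := (PolyGrowth.laplaceExp h).neg.mul hQ
  obtain ⟨g, hg, hb⟩ := exists_bromwich_bound h hQ' (half_pos hx) (x + 1) t
  have key := (hasDerivAt_integral_of_dominated_loc_of_deriv_le (μ := volume) (𝕜 := ℝ)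
    (F := fun x w => bromwichKernel c α lam Q x t w)
    (F' := fun x w => bromwichKernel c α lam
      (fun w => -laplaceExp c α lam (vline w) * Q w) x t w)
    (bound := g) (s := Ioo (x / 2) (x + 1)) (x₀ := x) (Ioo_mem_nhds (by linarith) (by linarith))
    (Eventually.of_forall fun x =>
      (continuous_bromwichKernel_right h hQ x t).aestronglyMeasurable)
    (integrable_bromwichKernel h hQ hx t)
    (continuous_bromwichKernel_right h hQ' x t).aestronglyMeasurable
    (ae_of_all _ fun w s hs => hb s t w hs.1.le hs.2.le le_rfl) hg
    (ae_of_all _ fun w s _ => ?_)).2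
  · exact Complex.reCLM.hasFDerivAt.comp_hasDerivAt x key
  · have h1 : HasDerivAt (fun s : ℝ => -((s : ℂ) * laplaceExp c α lam (vline w)))
        (-laplaceExp c α lam (vline w)) s := by
      simpa using ((Complex.ofRealCLM.hasDerivAt (x := s)).mul_const
        (laplaceExp c α lam (vline w))).fun_neg
    have := h1.cexp.const_mul (Complex.exp (vline w * t) * Q w)
    refine this.congr_deriv ?_
    simp only [bromwichKernel]
    ring

lemma measurable_bromwich (h : IsMixture c α lam) (hQ : PolyGrowth Q) :
    Measurable fun p : ℝ × ℝ => bromwich c α lam Q p.1 p.2 := by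
  have h1 : StronglyMeasurable fun q : (ℝ × ℝ) × ℝ => bromwichKernel c α lam Q q.1.1 q.1.2 q.2 := by
    apply Continuous.stronglyMeasurable
    exact (continuous_bromwichKernel h hQ).comp
      (f := fun q : (ℝ × ℝ) × ℝ => (q.1.1, q.1.2, q.2)) (by fun_prop)
  exact Complex.measurable_re.comp (h1.integral_prod_right (ν := volume)).measurable

lemma continuous_bromwich_right (h : IsMixture c α lam) (hQ : PolyGrowth Q) {x : ℝ} (hx : 0 < x) :
    Continuous fun t => bromwich c α lam Q x t :=
  continuous_iff_continuousAt.2 fun t => (hasDerivAt_bromwich_right h hQ hx t).continuousAt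

/-- A Bromwich integral that vanishes for `t < 0` also vanishes after multiplication of its symbol
by `z`, which amounts to differentiation in `t`. -/
lemma bromwich_vline_mul_of_neg (h : IsMixture c α lam) (hQ : PolyGrowth Q) {x : ℝ} (hx : 0 < x)
    (h0 : ∀ t < 0, bromwich c α lam Q x t = 0) {t : ℝ} (ht : t < 0) :
    bromwich c α lam (fun w => vline w * Q w) x t = 0 := by
  refine (hasDerivAt_bromwich_right h hQ hx t).unique ?_
  refine (hasDerivAt_const t (0 : ℝ)).congr_of_eventuallyEq ?_
  filter_upwards [Iio_mem_nhds ht] with s hs using h0 s hs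

lemma bromwich_zero_of_neg (h : IsMixture c α lam) (hQ : PolyGrowth Q) {x : ℝ} (hx : 0 < x)
    (h0 : ∀ t < 0, bromwich c α lam Q x t = 0) : bromwich c α lam Q x 0 = 0 := by
  have h1 : Tendsto (fun t => bromwich c α lam Q x t) (𝓝[<] 0) (𝓝 (bromwich c α lam Q x 0)) :=
    ((continuous_bromwich_right h hQ hx).tendsto 0).mono_left nhdsWithin_le_nhds
  refine tendsto_nhds_unique h1 ((tendsto_congr' ?_).2 tendsto_const_nhds)
  filter_upwards [self_mem_nhdsWithin] with s hs using h0 s hs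

end Bromwich

/-! ### Laplace transforms in the right half-plane and their inversion -/

/-- An identity between a Laplace transform and a holomorphic function that holds at real arguments
`s > 0` holds in the right half-plane. -/
lemma integral_cexp_eq_of_laplace {Ω : Type*} [MeasurableSpace Ω] {μ : Measure Ω} {X : Ω → ℝ}
    {g : ℂ → ℂ} (hg : DifferentiableOn ℂ g {z | 0 < z.re})
    (hint : ∀ s : ℝ, 0 < s → Integrable (fun ω => Real.exp (-s * X ω)) μ)
    (heq : ∀ s : ℝ, 0 < s → ((∫ ω, Real.exp (-s * X ω) ∂μ : ℝ) : ℂ) = g s)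
    {z : ℂ} (hz : 0 < z.re) : ∫ ω, Complex.exp (-z * X ω) ∂μ = g z := by
  have hopen : IsOpen {z : ℂ | 0 < z.re} := isOpen_lt continuous_const Complex.continuous_re
  have hsub : Iio (0 : ℝ) ⊆ interior (integrableExpSet X μ) := by
    refine isOpen_Iio.subset_interior_iff.2 fun s hs => ?_
    have := hint (-s) (by simpa using hs)
    simpa [integrableExpSet] using this
  have hf : DifferentiableOn ℂ (fun z => complexMGF X μ (-z)) {z | 0 < z.re} := by
    refine differentiableOn_complexMGF.comp differentiable_neg.differentiableOn fun z hz => ?_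
    exact hsub (by simpa using hz)
  have hconv : IsPreconnected {z : ℂ | 0 < z.re} :=
    (convex_halfSpace_re_gt 0).isPreconnected
  have htend : Tendsto (fun s : ℝ => (s : ℂ)) (𝓝[≠] 1) (𝓝[≠] ((1 : ℝ) : ℂ)) := by
    refine tendsto_nhdsWithin_iff.2 ⟨?_, ?_⟩
    · exact (Complex.continuous_ofReal.tendsto 1).mono_left nhdsWithin_le_nhds
    · filter_upwards [self_mem_nhdsWithin] with s hs
      simpa using hs
  have hfreq : ∃ᶠ z in 𝓝[≠] ((1 : ℝ) : ℂ), complexMGF X μ (-z) = g z := by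
    refine htend.frequently (Eventually.frequently ?_)
    filter_upwards [mem_nhdsWithin_of_mem_nhds (Ioi_mem_nhds (zero_lt_one (α := ℝ)))] with s hs
    rw [← heq s hs, ← Complex.ofReal_neg, complexMGF_ofReal]
    rfl
  exact (hf.analyticOnNhd hopen).eqOn_of_preconnected_of_frequently_eq (hg.analyticOnNhd hopen)
    hconv (by simp) hfreq hz

/-- The Gamma integral with a complex rate. -/
lemma integral_rpow_mul_cexp_neg {ν : ℝ} (hν : ν < 1) {z : ℂ} (hz : 0 < z.re) :
    ∫ v in Ioi (0 : ℝ), ((v ^ (-ν) : ℝ) : ℂ) * Complex.exp (-z * v) =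
      Real.Gamma (1 - ν) * z ^ ((ν - 1 : ℝ) : ℂ) := by
  set μ : Measure ℝ := (volume.restrict (Ioi 0)).withDensity
    (fun v => ENNReal.ofReal (v ^ (-ν))) with hμ
  have hm : Measurable fun v : ℝ => ENNReal.ofReal (v ^ (-ν)) := by fun_prop
  have hfin : ∀ᵐ v ∂(volume.restrict (Ioi (0 : ℝ))), ENNReal.ofReal (v ^ (-ν)) < ∞ :=
    ae_of_all _ fun v => ENNReal.ofReal_lt_top
  have hpos : ∀ᵐ v : ℝ ∂(volume.restrict (Ioi (0 : ℝ))),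
      (ENNReal.ofReal (v ^ (-ν))).toReal = v ^ (-ν) := by
    filter_upwards [ae_restrict_mem measurableSet_Ioi] with v hv
    exact ENNReal.toReal_ofReal (Real.rpow_nonneg (le_of_lt hv) _)
  have hint : ∀ s : ℝ, 0 < s → Integrable (fun v : ℝ => Real.exp (-s * id v)) μ := by
    intro s hs
    rw [hμ, integrable_withDensity_iff_integrable_smul₀' hm.aemeasurable hfin]
    have := integrableOn_rpow_mul_exp_neg_mul_rpow (p := 1) (s := -ν) (b := s) (by linarith)
      one_pos hs
    refine this.congr ?_
    filter_upwards [hpos] with v hv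
    simp only [smul_eq_mul, hv, id, Real.rpow_one]
  have key := integral_cexp_eq_of_laplace (μ := μ) (X := id)
    (g := fun z => Real.Gamma (1 - ν) * z ^ ((ν - 1 : ℝ) : ℂ)) ?_ hint ?_ hz
  · rw [← key, hμ, integral_withDensity_eq_integral_toReal_smul₀ hm.aemeasurable hfin]
    refine integral_congr_ae ?_
    filter_upwards [hpos] with v hv
    simp [hv]
  · intro z hz
    refine DifferentiableAt.differentiableWithinAt ?_
    exact ((hasDerivAt_id z).cpow_const (Or.inl hz)).differentiableAt.const_mul _
  · intro s hs
    rw [hμ, integral_withDensity_eq_integral_toReal_smul₀ hm.aemeasurable hfin]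
    have h1 := Real.integral_rpow_mul_exp_neg_mul_Ioi (a := 1 - ν) (r := s) (by linarith) hs
    have h2 : ∫ v in Ioi (0 : ℝ), (ENNReal.ofReal (v ^ (-ν))).toReal • Real.exp (-s * id v) =
        s ^ (ν - 1) * Real.Gamma (1 - ν) := by
      rw [show s ^ (ν - 1) = (1 / s) ^ (1 - ν) by
        rw [one_div, Real.inv_rpow hs.le, ← Real.rpow_neg hs.le]; ring_nf, ← h1]
      refine integral_congr_ae ?_
      filter_upwards [hpos] with v hv
      simp only [hv, id, smul_eq_mul]
      ring_nf
    rw [h2, mul_comm, Complex.ofReal_mul, Complex.ofReal_cpow hs.le]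

/-- The Fourier transform of `t ↦ e^{-t} μ (-∞, t]`, written as a Laplace transform on the line. -/
lemma integral_cexp_mul_cdf (μ : Measure ℝ) [IsProbabilityMeasure μ]
    (hμ : Integrable (fun y => Real.exp (-y)) μ) {z : ℂ} (hz : z.re = 1) :
    Integrable (fun t : ℝ => Complex.exp (-z * t) * cdf μ t) ∧
    ∫ t : ℝ, Complex.exp (-z * t) * cdf μ t = (∫ y, Complex.exp (-z * y) ∂μ) / z := by
  have hz0 : z ≠ 0 := by rintro rfl; simp at hz
  set f : ℝ × ℝ → ℂ := {p : ℝ × ℝ | p.2 ≤ p.1}.indicator fun p => Complex.exp (-z * p.1) with hf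
  have hS : MeasurableSet {p : ℝ × ℝ | p.2 ≤ p.1} := measurableSet_le measurable_snd measurable_fst
  have hfm : StronglyMeasurable f := by
    refine StronglyMeasurable.indicator ?_ hS
    apply Continuous.stronglyMeasurable
    fun_prop
  have hf1 : ∀ y, (fun t => f (t, y)) = (Ici y).indicator fun t : ℝ => Complex.exp (-z * t) := by
    intro y
    ext t
    simp [hf, indicator]
  have hf2 : ∀ t, (fun y => f (t, y)) = (Iic t).indicator fun _ => Complex.exp (-z * t) := by
    intro t
    ext y
    simp [hf, indicator]
  have hzre : (-z).re < 0 := by simp [hz]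
  have hi : ∀ y : ℝ, IntegrableOn (fun t : ℝ => Complex.exp (-z * t)) (Ici y) := fun y =>
    (integrableOn_Ici_iff_integrableOn_Ioi).2 (integrableOn_exp_mul_complex_Ioi hzre y)
  have hfint : Integrable f (volume.prod μ) := by
    rw [integrable_prod_iff' hfm.aestronglyMeasurable]
    refine ⟨ae_of_all _ fun y => ?_, ?_⟩
    · rw [hf1, integrable_indicator_iff measurableSet_Ici]
      exact hi y
    · refine hμ.congr (ae_of_all _ fun y => ?_)
      have : ∀ t, ‖f (t, y)‖ = (Ici y).indicator (fun t : ℝ => Real.exp (-1 * t)) t := by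
        intro t
        rw [congrFun (hf1 y) t, norm_indicator_eq_indicator_norm]
        simp [Complex.norm_exp, hz]
      simp_rw [this]
      rw [integral_indicator measurableSet_Ici, integral_Ici_eq_integral_Ioi,
        integral_exp_mul_Ioi (by norm_num)]
      simp
  have hcdf : ∀ t : ℝ, ∫ y, f (t, y) ∂μ = Complex.exp (-z * t) * cdf μ t := by
    intro t
    rw [hf2, integral_indicator measurableSet_Iic, setIntegral_const, ← cdf_eq_real]
    simp [mul_comm]
  refine ⟨?_, ?_⟩
  · refine hfint.integral_prod_left.congr (ae_of_all _ hcdf)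
  · calc ∫ t : ℝ, Complex.exp (-z * t) * cdf μ t = ∫ t, ∫ y, f (t, y) ∂μ := by simp_rw [hcdf]
      _ = ∫ y, (∫ t, f (t, y)) ∂μ :=
        integral_integral_swap (f := fun t y => f (t, y)) hfint
      _ = ∫ y, Complex.exp (-z * y) / z ∂μ := by
        refine integral_congr_ae (ae_of_all _ fun y => ?_)
        dsimp only
        rw [hf1, integral_indicator measurableSet_Ici, integral_Ici_eq_integral_Ioi,
          integral_exp_mul_complex_Ioi hzre]
        rw [neg_div_neg_eq]
      _ = _ := integral_div _ _

/-- Inversion of the Laplace transform of a distribution function. Fourier inversion gives it at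
the continuity points, and both sides are right-continuous. -/
lemma cdf_eq_integral_vline (μ : Measure ℝ) [IsProbabilityMeasure μ]
    (hμ : Integrable (fun y => Real.exp (-y)) μ) {G : ℝ → ℂ} (hG : Integrable G)
    (hGμ : ∀ w, G w = (∫ y, Complex.exp (-vline w * y) ∂μ) / vline w) (t : ℝ) :
    (cdf μ t : ℂ) = ∫ w, Complex.exp (vline w * t) * G w := by
  -- the factor `e^{-t}` makes the distribution function integrable and moves the line to `Re z = 1`
  set hfun : ℝ → ℂ := fun t => Complex.exp (-t) * cdf μ t with hh
  have hhi : Integrable hfun := by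
    simpa [hh] using (integral_cexp_mul_cdf μ hμ (z := 1) (by simp)).1
  have hF : FourierTransform.fourier hfun = G := by
    ext w
    rw [Real.fourier_eq', hGμ, ← (integral_cexp_mul_cdf μ hμ (vline_re w)).2]
    congr 1
    ext v
    simp only [hh, smul_eq_mul, ← mul_assoc, ← Complex.exp_add]
    congr 2
    simp [vline]
    ring
  have hE : ∀ s : ℝ, ∀ w, Complex.exp (vline w * s) * G w =
      Complex.exp s * (Complex.exp (((2 * Real.pi * inner ℝ w s : ℝ) : ℂ) * Complex.I) • G w) := by
    intro s w
    simp only [smul_eq_mul, ← mul_assoc, ← Complex.exp_add]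
    congr 2
    simp [vline]
    ring
  have hcont : ∀ s, ContinuousAt (cdf μ) s →
      (cdf μ s : ℂ) = ∫ w, Complex.exp (vline w * s) * G w := by
    intro s hs
    have h1 : ContinuousAt hfun s := by
      refine ContinuousAt.mul ?_ (Complex.continuous_ofReal.continuousAt.comp hs)
      fun_prop
    have h2 := hhi.fourierInv_fourier_eq (by rw [hF]; exact hG) h1
    rw [hF, Real.fourierInv_eq'] at h2
    simp_rw [hE, integral_const_mul, h2, hh, ← mul_assoc, ← Complex.exp_add]
    simp
  have hRcont : Continuous fun s : ℝ => ∫ w, Complex.exp (vline w * s) * G w := by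
    refine continuous_iff_continuousAt.2 fun s => ?_
    refine continuousAt_of_dominated (bound := fun w => Real.exp (s + 1) * ‖G w‖) ?_ ?_ ?_ ?_
    · refine Eventually.of_forall fun r => AEStronglyMeasurable.mul ?_ hG.aestronglyMeasurable
      exact (((continuous_vline.mul continuous_const).cexp).aestronglyMeasurable)
    · filter_upwards [Iio_mem_nhds (show s < s + 1 by linarith)] with r hr
      refine ae_of_all _ fun w => ?_
      rw [norm_mul, Complex.norm_exp]
      gcongr
      simpa using le_of_lt hr
    · exact hG.norm.const_mul _
    · refine ae_of_all _ fun w => ?_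
      fun_prop
  have hdense : Dense {s | ContinuousAt (cdf μ) s} := by
    have := (monotone_cdf μ).countable_not_continuousAt.dense_compl ℝ
    simpa [compl_ofPred] using this
  -- approach `t` from the right through continuity points
  have hne : (𝓝[Ioi t ∩ {s | ContinuousAt (cdf μ) s}] t).NeBot := by
    rw [← mem_closure_iff_nhdsWithin_neBot]
    have h1 : closure (Ioi t) ⊆ closure (Ioi t ∩ {s | ContinuousAt (cdf μ) s}) :=
      closure_minimal (hdense.open_subset_closure_inter isOpen_Ioi) isClosed_closure
    exact h1 (by simp)
  have l1 : Tendsto (fun s => (cdf μ s : ℂ)) (𝓝[Ioi t ∩ {s | ContinuousAt (cdf μ) s}] t)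
      (𝓝 (cdf μ t)) := by
    refine (Complex.continuous_ofReal.tendsto _).comp ?_
    have := (cdf μ).right_continuous t
    exact this.mono_left (nhdsWithin_mono _ (inter_subset_left.trans Ioi_subset_Ici_self))
  have l2 : Tendsto (fun s : ℝ => ∫ w, Complex.exp (vline w * s) * G w)
      (𝓝[Ioi t ∩ {s | ContinuousAt (cdf μ) s}] t) (𝓝 (∫ w, Complex.exp (vline w * t) * G w)) :=
    (hRcont.tendsto t).mono_left nhdsWithin_le_nhds
  refine tendsto_nhds_unique l1 (l2.congr' ?_)
  filter_upwards [self_mem_nhdsWithin] with s hs using (hcont s hs.2).symm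

/-! ### Shifted fractional derivatives of Bromwich integrals -/

lemma intervalIntegrable_sub_rpow {ν : ℝ} (hν : ν < 1) (t : ℝ) :
    IntervalIntegrable (fun τ : ℝ => (t - τ) ^ (-ν)) volume 0 t := by
  have := (intervalIntegral.intervalIntegrable_rpow' (a := 0) (b := t)
    (show -1 < -ν by linarith)).comp_sub_left t
  simpa using this.symm

lemma hasShiftedFracDeriv_of_continuous_deriv {g g' : ℝ → ℝ} (hg : ∀ τ, HasDerivAt g (g' τ) τ)
    (hg' : Continuous g') (a : ℝ) {ν : ℝ} (hν : ν < 1) (t : ℝ) : HasShiftedFracDeriv a ν g t := by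
  have hcont : Continuous g := continuous_iff_continuousAt.2 fun τ => (hg τ).continuousAt
  refine ⟨hcont.continuousOn, fun τ _ => (hg τ).differentiableAt, ?_, ?_⟩
  · have : deriv g = g' := funext fun τ => (hg τ).deriv
    rw [this]
    exact hg'.intervalIntegrable _ _
  · have h1 : ∀ τ, deriv (fun r => Real.exp (a * r) * g r) τ
        = Real.exp (a * τ) * (a * g τ + g' τ) := by
      intro τ
      have h2 : HasDerivAt (fun r => Real.exp (a * r)) (Real.exp (a * τ) * a) τ := by
        simpa using ((hasDerivAt_id τ).const_mul a).exp
      rw [(h2.fun_mul (hg τ)).deriv]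
      ring
    simp_rw [h1]
    refine (intervalIntegrable_sub_rpow hν t).mul_continuousOn ?_
    exact Continuous.continuousOn (by fun_prop)

section Bromwich

variable {c α lam : Fin 2 → ℝ} {Q : ℝ → ℂ}

lemma PolyGrowth.vline_add_mul (hQ : PolyGrowth Q) (l : ℝ) :
    PolyGrowth fun w => (_root_.vline w + l) * Q w :=
  (PolyGrowth.vline.add (PolyGrowth.const l)).mul hQ

lemma hasDerivAt_exp_mul_bromwich (h : IsMixture c α lam) (hQ : PolyGrowth Q) {x : ℝ} (hx : 0 < x)
    (l t : ℝ) : HasDerivAt (fun r => Real.exp (l * r) * bromwich c α lam Q x r)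
      (Real.exp (l * t) * bromwich c α lam (fun w => (vline w + l) * Q w) x t) t := by
  have h2 : HasDerivAt (fun r => Real.exp (l * r)) (Real.exp (l * t) * l) t := by
    simpa using ((hasDerivAt_id t).const_mul l).exp
  refine (h2.mul (hasDerivAt_bromwich_right h hQ hx t)).congr_deriv ?_
  simp_rw [add_mul]
  rw [bromwich_add h (PolyGrowth.vline.mul hQ) ((PolyGrowth.const l).mul hQ) hx,
    bromwich_real_mul]
  ring

/-- The fractional integral of order `1 - ν` from `-∞` acts on the exponentials in the Bromwich
integral by multiplication with `(z + l) ^ (ν - 1)`, by the Gamma integral. -/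
lemma integral_rpow_mul_bromwich (h : IsMixture c α lam) (hQ : PolyGrowth Q) {x : ℝ} (hx : 0 < x)
    {l ν : ℝ} (hl : 0 ≤ l) (hν : ν < 1) (t : ℝ) :
    ∫ v in Ioi (0 : ℝ), v ^ (-ν) * (Real.exp (l * (t - v)) *
      bromwich c α lam (fun w => (vline w + l) * Q w) x (t - v)) =
    Real.exp (l * t) * Real.Gamma (1 - ν) *
      bromwich c α lam (fun w => (vline w + l) ^ (ν : ℂ) * Q w) x t := by
  have hQl := hQ.vline_add_mul l
  have hQν := (PolyGrowth.vline_add_cpow hl hν.le).mul hQ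
  set A : ℝ → ℂ := fun w => Complex.exp (l * t) *
    bromwichKernel c α lam (fun w => (vline w + l) * Q w) x t w with hA
  have hAi : Integrable A := (integrable_bromwichKernel h hQl hx t).const_mul _
  set K : ℝ → ℝ → ℂ := fun v w => ((v ^ (-ν) : ℝ) : ℂ) * Complex.exp (-(vline w + l) * v) * A w
    with hK
  have hgam : IntegrableOn (fun v : ℝ => v ^ (-ν) * Real.exp (-(1 + l) * v)) (Ioi 0) := by
    have := integrableOn_rpow_mul_exp_neg_mul_rpow (p := 1) (s := -ν) (b := 1 + l) (by linarith)
      one_pos (by linarith)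
    simpa using this
  have hKint : Integrable (Function.uncurry K) ((volume.restrict (Ioi 0)).prod volume) := by
    refine (Integrable.mul_prod hgam hAi.norm).mono' ?_ ?_
    · refine AEStronglyMeasurable.mul (AEStronglyMeasurable.mul ?_ ?_) ?_
      · refine Measurable.aestronglyMeasurable ?_
        exact Complex.measurable_ofReal.comp (measurable_fst.pow_const _)
      · apply Continuous.aestronglyMeasurable
        have h1 : Continuous fun p : ℝ × ℝ => vline p.2 := continuous_vline.comp continuous_snd
        fun_prop
      · exact hAi.aestronglyMeasurable.comp_snd
    · have hfst : ∀ᵐ p : ℝ × ℝ ∂((volume.restrict (Ioi 0)).prod volume), 0 < p.1 := by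
        have := (Measure.quasiMeasurePreserving_fst (μ := volume.restrict (Ioi (0 : ℝ)))
          (ν := (volume : Measure ℝ))).ae (ae_restrict_mem measurableSet_Ioi)
        exact this
      filter_upwards [hfst] with p hp
      simp only [Function.uncurry, hK, norm_mul]
      gcongr
      · rw [Complex.norm_real, Real.norm_of_nonneg (Real.rpow_nonneg hp.le _)]
      · rw [Complex.norm_exp]
        simp
  have hKre : ∀ v, v ^ (-ν) * (Real.exp (l * (t - v)) *
      bromwich c α lam (fun w => (vline w + l) * Q w) x (t - v)) = (∫ w, K v w).re := by
    intro v
    have : ∀ w, K v w = ((v ^ (-ν) * Real.exp (l * (t - v)) : ℝ) : ℂ) *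
        bromwichKernel c α lam (fun w => (vline w + l) * Q w) x (t - v) w := by
      intro w
      have e : Complex.exp (-(vline w + l) * v) * Complex.exp (l * t) * Complex.exp (vline w * t)
          = Complex.exp (l * (t - v)) * Complex.exp (vline w * ((t - v : ℝ) : ℂ)) := by
        rw [← Complex.exp_add, ← Complex.exp_add, ← Complex.exp_add]
        congr 1
        push_cast
        ring
      simp only [hK, hA, bromwichKernel]
      push_cast at e ⊢
      linear_combination ((v ^ (-ν) : ℝ) : ℂ) * ((vline w + l) * Q w) *
        Complex.exp (-(x * laplaceExp c α lam (vline w))) * e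
    simp_rw [this]
    rw [integral_const_mul, Complex.re_ofReal_mul, bromwich, mul_assoc]
  simp_rw [hKre]
  have hswap := integral_integral_swap hKint
  have hre : ∫ v in Ioi (0 : ℝ), (∫ w, K v w).re = (∫ v in Ioi (0 : ℝ), ∫ w, K v w).re :=
    integral_re hKint.integral_prod_left
  rw [hre, hswap]
  have hinner : ∀ w, ∫ v in Ioi (0 : ℝ), K v w =
      ((Real.exp (l * t) * Real.Gamma (1 - ν) : ℝ) : ℂ) *
        bromwichKernel c α lam (fun w => (vline w + l) ^ (ν : ℂ) * Q w) x t w := by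
    intro w
    simp only [hK]
    have hpos : 0 < (vline w + l).re := by
      simp only [Complex.add_re, vline_re, Complex.ofReal_re]
      linarith
    have hne : vline w + l ≠ 0 := by intro h0; rw [h0] at hpos; simp at hpos
    rw [integral_mul_const, integral_rpow_mul_cexp_neg hν hpos]
    have e : (vline w + l) ^ ((ν - 1 : ℝ) : ℂ) * (vline w + l) = (vline w + l) ^ (ν : ℂ) := by
      rw [Complex.ofReal_sub, Complex.ofReal_one, Complex.cpow_sub _ _ hne, Complex.cpow_one]
      field_simp
    simp only [hA, bromwichKernel]
    rw [← e]
    push_cast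
    ring
  simp_rw [hinner]
  rw [integral_const_mul, Complex.re_ofReal_mul, bromwich]

/-- The fractional integral over `(0, t)` in `shiftedFracDeriv`, for a Bromwich integral that
vanishes for negative times. -/
lemma integral_sub_rpow_mul_bromwich (h : IsMixture c α lam) (hQ : PolyGrowth Q) {x : ℝ}
    (hx : 0 < x) (h0 : ∀ t < 0, bromwich c α lam Q x t = 0) {l ν : ℝ} (hl : 0 ≤ l)
    (hν : ν < 1) {t : ℝ} (ht : 0 ≤ t) :
    ∫ τ in (0 : ℝ)..t, (t - τ) ^ (-ν) * (Real.exp (l * τ) *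
      bromwich c α lam (fun w => (vline w + l) * Q w) x τ) =
    Real.exp (l * t) * Real.Gamma (1 - ν) *
      bromwich c α lam (fun w => (vline w + l) ^ (ν : ℂ) * Q w) x t := by
  -- substitute `v = t - τ`; the integrand over `v > t` vanishes
  rw [← integral_rpow_mul_bromwich h hQ hx hl hν t]
  have e1 := intervalIntegral.integral_comp_sub_left (a := 0) (b := t) (fun τ =>
    (t - τ) ^ (-ν) * (Real.exp (l * τ) *
      bromwich c α lam (fun w => (vline w + l) * Q w) x τ)) t
  rw [sub_self, sub_zero] at e1
  rw [← e1, intervalIntegral.integral_of_le ht]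
  simp only [sub_sub_cancel]
  symm
  apply setIntegral_eq_of_subset_of_forall_sdiff_eq_zero measurableSet_Ioi Ioc_subset_Ioi_self
  intro v hv
  have hvt : t - v < 0 := by
    have h1 := hv.1
    have h2 := hv.2
    simp only [mem_Ioi, mem_Ioc, not_and, not_le] at h1 h2
    linarith [h2 h1]
  have h3 : bromwich c α lam (fun w => (vline w + l) * Q w) x (t - v) = 0 := by
    simp_rw [add_mul]
    rw [bromwich_add h (PolyGrowth.vline.mul hQ) ((PolyGrowth.const l).mul hQ) hx,
      bromwich_real_mul, h0 _ hvt, bromwich_vline_mul_of_neg h hQ hx h0 hvt]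
    simp
  rw [h3, mul_zero, mul_zero]

lemma hasShiftedFracDeriv_bromwich (h : IsMixture c α lam) (hQ : PolyGrowth Q) {x : ℝ} (hx : 0 < x)
    (l : ℝ) {ν : ℝ} (hν : ν < 1) (t : ℝ) :
    HasShiftedFracDeriv l ν (fun r => bromwich c α lam Q x r) t :=
  hasShiftedFracDeriv_of_continuous_deriv (hasDerivAt_bromwich_right h hQ hx)
    (continuous_bromwich_right h (PolyGrowth.vline.mul hQ) hx) l hν t

/-- On Bromwich integrals that vanish for negative times the shifted fractional derivative acts as
multiplication of the symbol by `(z + l) ^ ν`. -/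
lemma shiftedFracDeriv_bromwich (h : IsMixture c α lam) (hQ : PolyGrowth Q) {x : ℝ} (hx : 0 < x)
    (h0 : ∀ t < 0, bromwich c α lam Q x t = 0) {l ν : ℝ} (hl : 0 ≤ l) (hν : ν < 1)
    {t : ℝ} (ht : 0 ≤ t) :
    shiftedFracDeriv l ν (fun r => bromwich c α lam Q x r) t =
      bromwich c α lam (fun w => (vline w + l) ^ (ν : ℂ) * Q w) x t := by
  unfold shiftedFracDeriv
  simp_rw [(hasDerivAt_exp_mul_bromwich h hQ hx l _).deriv]
  rw [integral_sub_rpow_mul_bromwich h hQ hx h0 hl hν ht]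
  have hG : Real.Gamma (1 - ν) ≠ 0 := (Real.Gamma_pos_of_pos (by linarith)).ne'
  have hE : Real.exp (-l * t) * Real.exp (l * t) = 1 := by rw [← Real.exp_add]; simp
  linear_combination (bromwich c α lam (fun w => (vline w + l) ^ (ν : ℂ) * Q w) x t) *
    (hE + Real.exp (-l * t) * Real.exp (l * t) * inv_mul_cancel₀ hG)

/-- The weighted sum of the fractional derivatives multiplies the symbol by the Laplace
exponent. -/
lemma sum_shiftedFracDeriv_bromwich (h : IsMixture c α lam) (hQ : PolyGrowth Q) {x : ℝ}
    (hx : 0 < x) (h0 : ∀ t < 0, bromwich c α lam Q x t = 0) {t : ℝ} (ht : 0 ≤ t) :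
    ∑ i, c i * shiftedFracDeriv (lam i) (α i) (fun r => bromwich c α lam Q x r) t
      - (∑ i, c i * lam i ^ α i) * bromwich c α lam Q x t =
    bromwich c α lam (fun w => laplaceExp c α lam (vline w) * Q w) x t := by
  have hP : ∀ i, PolyGrowth fun w => (vline w + lam i) ^ (α i : ℂ) * Q w := fun i =>
    (PolyGrowth.vline_add_cpow (h.lam_nonneg i) (h.α_mem i).2.le).mul hQ
  have e : (fun w => laplaceExp c α lam (vline w) * Q w) = fun w =>
      (((c 0 : ℝ) : ℂ) * ((vline w + lam 0) ^ (α 0 : ℂ) * Q w)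
        + ((c 1 : ℝ) : ℂ) * ((vline w + lam 1) ^ (α 1 : ℂ) * Q w))
        + ((-IsMixture.killing c α lam : ℝ) : ℂ) * Q w := by
    ext w
    rw [IsMixture.laplaceExp_eq, Fin.sum_univ_two]
    push_cast
    ring
  rw [e, bromwich_add h (((PolyGrowth.const _).mul (hP 0)).add ((PolyGrowth.const _).mul (hP 1)))
    ((PolyGrowth.const _).mul hQ) hx, bromwich_add h ((PolyGrowth.const _).mul (hP 0))
    ((PolyGrowth.const _).mul (hP 1)) hx, bromwich_real_mul, bromwich_real_mul, bromwich_real_mul]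
  simp_rw [fun i => shiftedFracDeriv_bromwich h hQ hx h0 (h.lam_nonneg i)
    (h.α_mem i).2 ht]
  rw [Fin.sum_univ_two, IsMixture.killing]
  ring

end Bromwich

/-! ### Marginal laws and paths of the subordinator -/

namespace IsMTSS

variable {Ω : Type*} [MeasurableSpace Ω] {P : Measure Ω} {c α lam : Fin 2 → ℝ} {S : ℝ≥0 → Ω → ℝ}

lemma integrable_exp (hS : IsMTSS c α lam S P) (t : ℝ≥0) {s : ℝ} (hs : 0 < s) :
    Integrable (fun ω => Real.exp (-s * S t ω)) P := by
  by_contra hcon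
  have h1 := hS.laplace t s hs
  rw [integral_undef hcon] at h1
  exact (Real.exp_pos _).ne h1

lemma integral_cexp (h : IsMixture c α lam) (hS : IsMTSS c α lam S P) (t : ℝ≥0) {z : ℂ}
    (hz : 0 < z.re) :
    ∫ ω, Complex.exp (-z * S t ω) ∂P = Complex.exp (-(t * laplaceExp c α lam z)) := by
  refine integral_cexp_eq_of_laplace (g := fun z => Complex.exp (-(t * laplaceExp c α lam z)))
    ?_ (fun s hs => hS.integrable_exp t hs) ?_ hz
  · intro z hz
    refine DifferentiableAt.differentiableWithinAt ?_
    have := (h.differentiableAt_laplaceExp hz).differentiableAt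
    fun_prop
  · intro s hs
    rw [hS.laplace t s hs, h.laplaceExp_ofReal hs]
    push_cast
    ring_nf

lemma mtssExponent_nonneg (h : IsMixture c α lam) {s : ℝ} (hs : 0 ≤ s) :
    0 ≤ mtssExponent c α lam s := by
  refine Finset.sum_nonneg fun i _ => mul_nonneg (h.c_nonneg i) (sub_nonneg.2 ?_)
  exact Real.rpow_le_rpow (h.lam_nonneg i) (by linarith) (h.α_mem i).1.le

lemma mtssExponent_pos (h : IsMixture c α lam) {s : ℝ} (hs : 0 < s) :
    0 < mtssExponent c α lam s := by
  have hlt : ∀ i, 0 < (s + lam i) ^ α i - lam i ^ α i := fun i =>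
    sub_pos.2 (Real.rpow_lt_rpow (h.lam_nonneg i) (by linarith) (h.α_mem i).1)
  obtain ⟨i, hi⟩ : ∃ i, 0 < c i := by
    by_contra! hcon
    have : ∑ i, c i ≤ 0 := Finset.sum_nonpos fun i _ => hcon i
    linarith [h.c_sum]
  exact Finset.sum_pos' (fun j _ => mul_nonneg (h.c_nonneg j) (hlt j).le)
    ⟨i, Finset.mem_univ i, mul_pos hi (hlt i)⟩

/-- The exponential Markov inequality for the lower tail. -/
lemma measureReal_le_le [IsProbabilityMeasure P] (hS : IsMTSS c α lam S P) (t : ℝ≥0) (y : ℝ)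
    {s : ℝ} (hs : 0 < s) :
    P.real {ω | S t ω ≤ y} ≤ Real.exp (s * y) * Real.exp (-t * mtssExponent c α lam s) := by
  have h1 := measure_le_le_exp_mul_mgf (X := S t) (μ := P) y (t := -s) (by linarith)
    (hS.integrable_exp t hs)
  rw [neg_neg] at h1
  refine h1.trans_eq ?_
  rw [← hS.laplace t s hs]
  rfl

/-- A nonnegative Laplace exponent forces a nonnegative variable: let `s → ∞` in the exponential
Markov inequality for `P (S t ≤ -1 / (n + 1))`. -/
lemma ae_nonneg [IsProbabilityMeasure P] (h : IsMixture c α lam) (hS : IsMTSS c α lam S P)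
    (t : ℝ≥0) : ∀ᵐ ω ∂P, 0 ≤ S t ω := by
  have key : ∀ n : ℕ, P {ω | S t ω ≤ -(1 / ((n : ℝ) + 1))} = 0 := by
    intro n
    have hn : 0 < 1 / ((n : ℝ) + 1) := by positivity
    have h1 : ∀ s : ℝ, 0 < s →
        P.real {ω | S t ω ≤ -(1 / ((n : ℝ) + 1))} ≤ Real.exp (-(s * (1 / ((n : ℝ) + 1)))) := by
      intro s hs
      refine (hS.measureReal_le_le t _ hs).trans ?_
      rw [← Real.exp_add]
      apply Real.exp_le_exp.2
      have := mul_nonneg t.2 (mtssExponent_nonneg h hs.le)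
      simp only [NNReal.val_eq_coe] at this
      linarith
    have h2 : Tendsto (fun s : ℝ => Real.exp (-(s * (1 / ((n : ℝ) + 1))))) atTop (𝓝 0) :=
      Real.tendsto_exp_neg_atTop_nhds_zero.comp (tendsto_id.atTop_mul_const hn)
    have h3 : P.real {ω | S t ω ≤ -(1 / ((n : ℝ) + 1))} ≤ 0 :=
      ge_of_tendsto h2 ((eventually_gt_atTop 0).mono h1)
    exact (measureReal_eq_zero_iff).1 (le_antisymm h3 measureReal_nonneg)
  have h1 : ∀ᵐ ω ∂P, ∀ n : ℕ, ¬ S t ω ≤ -(1 / ((n : ℝ) + 1)) := by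
    rw [ae_all_iff]
    intro n
    rw [ae_iff]
    simpa using key n
  filter_upwards [h1] with ω hω
  by_contra! hneg
  obtain ⟨n, hn⟩ := exists_nat_one_div_lt (neg_pos.2 hneg)
  exact hω n (by linarith)

/-- The distribution function of `S x` as a Bromwich integral. -/
lemma cdf_map_eq [IsProbabilityMeasure P] (h : IsMixture c α lam) (hS : IsMTSS c α lam S P)
    {x : ℝ≥0} (hx : 0 < x) (t : ℝ) :
    cdf (P.map (S x)) t = bromwich c α lam (fun w => (vline w)⁻¹) x t := by
  have hm := hS.measurable x
  have := Measure.isProbabilityMeasure_map (μ := P) hm.aemeasurable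
  have hx' : (0 : ℝ) < x := hx
  have hk := integrable_bromwichKernel h PolyGrowth.vline_inv hx' 0
  have key := cdf_eq_integral_vline (P.map (S x)) ?_ hk (fun w => ?_) t
  · unfold bromwich
    rw [← Complex.ofReal_re (cdf (P.map (S x)) t), key]
    congr 2
    ext w
    simp only [bromwichKernel]
    simp
    ring
  · rw [integrable_map_measure (by fun_prop) hm.aemeasurable]
    simpa [Function.comp_def] using hS.integrable_exp x one_pos
  · have h1 := integral_map (μ := P) hm.aemeasurable
      (f := fun y : ℝ => Complex.exp (-vline w * y)) (by fun_prop)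
    rw [h1, hS.integral_cexp h x (by simp)]
    simp only [bromwichKernel]
    simp
    ring

lemma measureReal_le_eq [IsProbabilityMeasure P] (h : IsMixture c α lam)
    (hS : IsMTSS c α lam S P) {x : ℝ≥0} (hx : 0 < x) (t : ℝ) :
    P.real {ω | S x ω ≤ t} = bromwich c α lam (fun w => (vline w)⁻¹) x t := by
  have hm := hS.measurable x
  have := Measure.isProbabilityMeasure_map (μ := P) hm.aemeasurable
  rw [← hS.cdf_map_eq h hx, cdf_eq_real, map_measureReal_apply hm measurableSet_Iic]
  rfl

/-- The Bromwich integral of `1 / z` vanishes for negative times, because `S ≥ 0`. -/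
lemma bromwich_eq_zero [IsProbabilityMeasure P] (h : IsMixture c α lam)
    (hS : IsMTSS c α lam S P) {x : ℝ} (hx : 0 < x) {t : ℝ} (ht : t < 0) :
    bromwich c α lam (fun w => (vline w)⁻¹) x t = 0 := by
  lift x to ℝ≥0 using hx.le
  rw [← hS.measureReal_le_eq h (by exact_mod_cast hx), measureReal_eq_zero_iff]
  refine measure_mono_null (fun ω hω => ?_) (ae_iff.1 (hS.ae_nonneg h x))
  simp only [mem_ofPred_eq] at hω ⊢
  linarith

/-- The law of `S x` has no atoms: its distribution function is a continuous Bromwich integral. -/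
lemma measure_eq_zero [IsProbabilityMeasure P] (h : IsMixture c α lam)
    (hS : IsMTSS c α lam S P) {x : ℝ≥0} (hx : 0 < x) (t : ℝ) : P {ω | S x ω = t} = 0 := by
  have hx' : (0 : ℝ) < x := hx
  have hm := hS.measurable x
  have := Measure.isProbabilityMeasure_map (μ := P) hm.aemeasurable
  have h1 : (P.map (S x)) {t} = 0 := by
    rw [← measure_cdf (P.map (S x)), StieltjesFunction.measure_singleton]
    have hc : Continuous (cdf (P.map (S x))) := by
      have : (cdf (P.map (S x)) : ℝ → ℝ) = fun t => bromwich c α lam (fun w => (vline w)⁻¹) x t :=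
        funext fun t => hS.cdf_map_eq h hx t
      rw [this]
      exact continuous_bromwich_right h PolyGrowth.vline_inv hx'
    have := (hc.continuousAt (x := t)).continuousWithinAt.leftLim_eq (f := cdf (P.map (S x)))
    rw [this, sub_self, ENNReal.ofReal_zero]
  rw [Measure.map_apply hm (measurableSet_singleton t)] at h1
  exact h1

end IsMTSS

/-- The almost sure properties of the paths of a strictly positive subordinator that determine
its first exit times. -/
structure IsSubordinatorPath (f : ℝ≥0 → ℝ) : Prop where
  mono : Monotone f
  rightCont : ∀ u, ContinuousWithinAt f (Ici u) u
  zero : f 0 = 0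
  pos : ∀ u, 0 < u → 0 < f u
  unbounded : ∀ y, ∃ u, y < f u

/-- A right-continuous function that increases along the rationals is monotone. -/
lemma monotone_of_rightCont {f : ℝ≥0 → ℝ} (hf : ∀ u, ContinuousWithinAt f (Ici u) u)
    (hq : ∀ p q : ℚ, Real.toNNReal p ≤ Real.toNNReal q →
      f (Real.toNNReal p) ≤ f (Real.toNNReal q)) : Monotone f := by
  intro u v huv
  rcases huv.eq_or_lt with rfl | huv
  · exact le_rfl
  by_contra! hcon
  obtain ⟨m, hm1, hm2⟩ := exists_between hcon
  have e1 : ∀ᶠ p in 𝓝[>] u, m < f p :=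
    ((hf u).mono_left (nhdsWithin_mono _ Ioi_subset_Ici_self)).eventually (lt_mem_nhds hm2)
  have e2 : ∀ᶠ p in 𝓝[>] v, f p < m :=
    ((hf v).mono_left (nhdsWithin_mono _ Ioi_subset_Ici_self)).eventually (gt_mem_nhds hm1)
  obtain ⟨a, ha, ha'⟩ := (mem_nhdsGT_iff_exists_Ioo_subset' huv).1 e1
  obtain ⟨b, hb, hb'⟩ := (mem_nhdsGT_iff_exists_Ioo_subset' (show v < v + 1 by simp)).1 e2
  obtain ⟨p, -, hp1, hp2⟩ := (NNReal.lt_iff_exists_rat_btwn u (min a v)).1 (lt_min ha huv)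
  obtain ⟨q, -, hq1, hq2⟩ := (NNReal.lt_iff_exists_rat_btwn v b).1 hb
  have h1 := ha' ⟨hp1, hp2.trans_le (min_le_left _ _)⟩
  have h2 := hb' ⟨hq1, hq2⟩
  have h3 := hq p q ((hp2.le.trans (min_le_right _ _)).trans hq1.le)
  simp only [mem_ofPred_eq] at h1 h2
  linarith

/-- Monotonicity comes from stationary nonnegative increments at rational times, positivity from
the absence of atoms, and unboundedness from the decay of `P (S n ≤ k)` in `n`. -/
lemma IsMTSS.ae_isSubordinatorPath {Ω : Type*} [MeasurableSpace Ω] {P : Measure Ω}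
    [IsProbabilityMeasure P] {c α lam : Fin 2 → ℝ} {S : ℝ≥0 → Ω → ℝ} (h : IsMixture c α lam)
    (hS : IsMTSS c α lam S P) : ∀ᵐ ω ∂P, IsSubordinatorPath fun u => S u ω := by
  have hmono : ∀ᵐ ω ∂P, ∀ p q : ℚ, Real.toNNReal p ≤ Real.toNNReal q →
      S (Real.toNNReal p) ω ≤ S (Real.toNNReal q) ω := by
    simp_rw [ae_all_iff]
    intro p q hpq
    have h1 := hS.stationaryIncrements (Real.toNNReal p) (Real.toNNReal q - Real.toNNReal p)
    rw [add_tsub_cancel_of_le hpq] at h1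
    filter_upwards [h1.symm.ae_snd (p := fun y => 0 ≤ y) measurableSet_Ici
      (hS.ae_nonneg h _)] with ω hω
    simpa using hω
  have hpos : ∀ᵐ ω ∂P, ∀ n : ℕ, S (1 / ((n : ℝ≥0) + 1)) ω ≠ 0 := by
    rw [ae_all_iff]
    intro n
    rw [ae_iff]
    simpa using hS.measure_eq_zero h (x := 1 / ((n : ℝ≥0) + 1)) (by positivity) 0
  have hunb : ∀ᵐ ω ∂P, ∀ k : ℕ, ∃ n : ℕ, (k : ℝ) < S n ω := by
    rw [ae_all_iff]
    intro k
    have h1 : ∀ n : ℕ, P.real {ω | ∀ n : ℕ, S n ω ≤ k} ≤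
        Real.exp (1 * k) * Real.exp (-((n : ℝ) * mtssExponent c α lam 1)) := by
      intro n
      refine (measureReal_mono (s₂ := {ω | S n ω ≤ k})
        (fun ω (hω : ∀ n : ℕ, S n ω ≤ k) => hω n)).trans
        ((hS.measureReal_le_le n (k : ℝ) one_pos).trans_eq ?_)
      simp
    have h2 : Tendsto (fun n : ℕ => Real.exp (1 * k) *
        Real.exp (-((n : ℝ) * mtssExponent c α lam 1))) atTop (𝓝 (Real.exp (1 * k) * 0)) := by
      refine Tendsto.const_mul _ (Real.tendsto_exp_neg_atTop_nhds_zero.comp ?_)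
      exact tendsto_natCast_atTop_atTop.atTop_mul_const (IsMTSS.mtssExponent_pos h one_pos)
    rw [mul_zero] at h2
    have h3 := ge_of_tendsto' h2 h1
    rw [ae_iff]
    simpa using (measureReal_eq_zero_iff).1 (le_antisymm h3 measureReal_nonneg)
  filter_upwards [hmono, hpos, hunb, hS.zero, hS.cadlag] with ω h1 h2 h3 h4 h5
  have hr : ∀ u, ContinuousWithinAt (fun u => S u ω) (Ici u) u := fun u => (h5 u).1
  have hm : Monotone fun u => S u ω := monotone_of_rightCont hr h1
  refine ⟨hm, hr, h4, fun u hu => ?_, fun y => ?_⟩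
  · obtain ⟨n, hn⟩ := exists_nat_one_div_lt hu
    have a1 : S 0 ω ≤ S (1 / ((n : ℝ≥0) + 1)) ω := hm zero_le
    have a2 : S (1 / ((n : ℝ≥0) + 1)) ω ≤ S u ω := hm hn.le
    rw [h4] at a1
    exact (lt_of_le_of_ne a1 (h2 n).symm).trans_le a2
  · obtain ⟨k, hk⟩ := exists_nat_gt y
    obtain ⟨n, hn⟩ := h3 k
    exact ⟨n, hk.trans hn⟩

/-! ### First exit times -/

namespace IsSubordinatorPath

variable {Ω : Type*} {S : ℝ≥0 → Ω → ℝ} {ω : Ω}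

lemma firstExit_le (S : ℝ≥0 → Ω → ℝ) (ω : Ω) {t : ℝ} {u : ℝ≥0} (hu : 0 < u) (h : t < S u ω) :
    firstExit S t ω ≤ u := by
  unfold firstExit
  exact_mod_cast csInf_le (OrderBot.bddBelow _)
    (show u ∈ {u : ℝ≥0 | 0 < u ∧ t < S u ω} from ⟨hu, h⟩)

lemma exitSet_nonempty (hf : IsSubordinatorPath fun u => S u ω) (t : ℝ) :
    {u : ℝ≥0 | 0 < u ∧ t < S u ω}.Nonempty := by
  obtain ⟨u, hu⟩ := hf.unbounded t
  exact ⟨u + 1, by positivity, hu.trans_le (hf.mono (by simp))⟩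

lemma le_firstExit (hf : IsSubordinatorPath fun u => S u ω) {t : ℝ} {u : ℝ≥0} (h : S u ω ≤ t) :
    (u : ℝ) ≤ firstExit S t ω := by
  unfold firstExit
  have : u ≤ sInf {u : ℝ≥0 | 0 < u ∧ t < S u ω} := by
    refine le_csInf (hf.exitSet_nonempty t) fun v hv => ?_
    by_contra! hlt
    have h1 : S v ω ≤ S u ω := hf.mono hlt.le
    linarith [hv.2]
  exact_mod_cast this

lemma firstExit_nonneg (S : ℝ≥0 → Ω → ℝ) (t : ℝ) (ω : Ω) : 0 ≤ firstExit S t ω :=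
  NNReal.coe_nonneg _

lemma lt_firstExit (hf : IsSubordinatorPath fun u => S u ω) {t : ℝ} {u : ℝ≥0} (h : S u ω < t) :
    (u : ℝ) < firstExit S t ω := by
  have e1 : ∀ᶠ p in 𝓝[>] u, S p ω < t :=
    ((hf.rightCont u).mono_left (nhdsWithin_mono _ Ioi_subset_Ici_self)).eventually
      (gt_mem_nhds h)
  obtain ⟨v, hv, huv⟩ := (e1.and self_mem_nhdsWithin).exists
  exact lt_of_lt_of_le (by exact_mod_cast huv) (hf.le_firstExit hv.le)

lemma firstExit_zero (hf : IsSubordinatorPath fun u => S u ω) : firstExit S 0 ω = 0 := by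
  refine le_antisymm (le_of_forall_pos_le_add fun ε hε => ?_) (firstExit_nonneg S 0 ω)
  lift ε to ℝ≥0 using hε.le
  rw [zero_add]
  exact firstExit_le S ω (by exact_mod_cast hε) (hf.pos ε (by exact_mod_cast hε))

lemma firstExit_pos (hf : IsSubordinatorPath fun u => S u ω) {t : ℝ} (ht : 0 < t) :
    0 < firstExit S t ω := by
  have := hf.lt_firstExit (t := t) (u := 0) (by rw [hf.zero]; exact ht)
  simpa using this

lemma tendsto_firstExit (hf : IsSubordinatorPath fun u => S u ω) :
    Tendsto (fun t => firstExit S t ω) (𝓝[>] 0) (𝓝 0) := by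
  rw [tendsto_order]
  refine ⟨fun a ha => Eventually.of_forall fun t => ha.trans_le (firstExit_nonneg S t ω),
    fun a ha => ?_⟩
  lift a to ℝ≥0 using ha.le
  have ha' : 0 < a / 2 := half_pos (by exact_mod_cast ha)
  have h1 := hf.pos (a / 2) ha'
  filter_upwards [mem_nhdsWithin_of_mem_nhds (Iio_mem_nhds h1)] with t ht
  refine (firstExit_le S ω ha' ht).trans_lt ?_
  push_cast
  linarith

/-- By right-continuity the exit time is determined by the path at rational times. -/
lemma firstExit_lt_iff (hf : IsSubordinatorPath fun u => S u ω) (t x : ℝ) :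
    firstExit S t ω < x ↔ ∃ q : ℚ, 0 < q ∧ (q : ℝ) < x ∧ t < S (Real.toNNReal q) ω := by
  constructor
  · intro hlt
    have hx : 0 < x := (firstExit_nonneg S t ω).trans_lt hlt
    lift x to ℝ≥0 using hx.le
    unfold firstExit at hlt
    obtain ⟨u, hu, hux⟩ := exists_lt_of_csInf_lt (hf.exitSet_nonempty t) (NNReal.coe_lt_coe.1 hlt)
    have e1 : ∀ᶠ p in 𝓝[>] u, t < S p ω :=
      ((hf.rightCont u).mono_left (nhdsWithin_mono _ Ioi_subset_Ici_self)).eventually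
        (lt_mem_nhds hu.2)
    obtain ⟨a, ha, ha'⟩ := (mem_nhdsGT_iff_exists_Ioo_subset' hux).1 e1
    obtain ⟨q, hq0, hq1, hq2⟩ := (NNReal.lt_iff_exists_rat_btwn u (min a x)).1 (lt_min ha hux)
    refine ⟨q, ?_, ?_, ha' ⟨hq1, hq2.trans_le (min_le_left _ _)⟩⟩
    · have h1 := hu.1.trans hq1
      rw [Real.toNNReal_pos] at h1
      exact_mod_cast h1
    · have h1 : Real.toNNReal q < x := hq2.trans_le (min_le_right _ _)
      have h2 := NNReal.coe_lt_coe.2 h1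
      rwa [Real.coe_toNNReal _ (by exact_mod_cast hq0)] at h2
  · rintro ⟨q, hq0, hqx, hq⟩
    have hq0' : (0 : ℝ) < q := by exact_mod_cast hq0
    refine (firstExit_le S ω (Real.toNNReal_pos.2 hq0') hq).trans_lt ?_
    rwa [Real.coe_toNNReal _ hq0'.le]

end IsSubordinatorPath

namespace IsMTSS

variable {Ω : Type*} [MeasurableSpace Ω] {P : Measure Ω} [IsProbabilityMeasure P]
  {c α lam : Fin 2 → ℝ} {S : ℝ≥0 → Ω → ℝ}

lemma aemeasurable_firstExit (h : IsMixture c α lam) (hS : IsMTSS c α lam S P) (t : ℝ) :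
    AEMeasurable (firstExit S t) P := by
  have hset : ∀ x : ℝ, NullMeasurableSet {ω | firstExit S t ω < x} P := fun x => by
    have hm : MeasurableSet
        (⋃ q : ℚ, {ω | 0 < q ∧ (q : ℝ) < x ∧ t < S (Real.toNNReal q) ω}) := by
      refine MeasurableSet.iUnion fun q => ?_
      refine (MeasurableSet.const _).inter ((MeasurableSet.const _).inter ?_)
      exact measurableSet_lt measurable_const (hS.measurable _)
    refine NullMeasurableSet.congr hm.nullMeasurableSet ?_
    filter_upwards [hS.ae_isSubordinatorPath h] with ω hω
    rw [eq_iff_iff]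
    change ω ∈ (⋃ q : ℚ, {ω | 0 < q ∧ (q : ℝ) < x ∧ t < S (Real.toNNReal q) ω}) ↔
      firstExit S t ω < x
    rw [hω.firstExit_lt_iff t x]
    simp
  have hnull : NullMeasurable (firstExit S t) P :=
    measurable_of_Iio (δ := NullMeasurableSpace Ω P) hset
  exact hnull.aemeasurable

/-- Duality between the subordinator and its inverse: `E(t) > x` exactly when `S(x) ≤ t`, almost
surely. -/
lemma measureReal_lt_firstExit (h : IsMixture c α lam) (hS : IsMTSS c α lam S P) {x : ℝ}
    (hx : 0 < x) (t : ℝ) :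
    P.real {ω | x < firstExit S t ω} = bromwich c α lam (fun w => (vline w)⁻¹) x t := by
  lift x to ℝ≥0 using hx.le
  have hx' : 0 < x := by exact_mod_cast hx
  rw [← hS.measureReal_le_eq h hx']
  refine measureReal_congr ?_
  have h0 : ∀ᵐ ω ∂P, S x ω ≠ t := by
    rw [ae_iff]
    simpa using hS.measure_eq_zero h hx' t
  filter_upwards [hS.ae_isSubordinatorPath h, h0] with ω hω hne
  rw [eq_iff_iff]
  change (x : ℝ) < firstExit S t ω ↔ S x ω ≤ t
  constructor
  · intro hlt
    by_contra! hcon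
    exact absurd (IsSubordinatorPath.firstExit_le S ω hx' hcon) (not_le.2 hlt)
  · intro hle
    exact hω.lt_firstExit (lt_of_le_of_ne hle hne)

end IsMTSS

/-! ### The density of the first exit time -/

lemma bromwich_neg {c α lam : Fin 2 → ℝ} (Q : ℝ → ℂ) (x t : ℝ) :
    bromwich c α lam (fun w => -Q w) x t = -bromwich c α lam Q x t := by
  have := bromwich_real_mul (c := c) (α := α) (lam := lam) (-1) Q x t
  simpa using this

/-- The survival function `P(E(t) > x) = P(S(x) ≤ t)`: the inverse Laplace transform in `t` of
`s⁻¹ e^{-x φ(s)}`. -/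
noncomputable def survival (c α lam : Fin 2 → ℝ) (x t : ℝ) : ℝ :=
  bromwich c α lam (fun w => (vline w)⁻¹) x t

/-- The density of `S(x)` at `t`: the inverse Laplace transform in `t` of `e^{-x φ(s)}`. -/
noncomputable def subordinatorDensity (c α lam : Fin 2 → ℝ) (x t : ℝ) : ℝ :=
  bromwich c α lam (fun _ => 1) x t

/-- The density of `E(t)` at `x`: the inverse Laplace transform in `t` of
`φ(s) s⁻¹ e^{-x φ(s)}`. -/
noncomputable def exitDensity (c α lam : Fin 2 → ℝ) (x t : ℝ) : ℝ :=
  bromwich c α lam (fun w => laplaceExp c α lam (vline w) * (vline w)⁻¹) x t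

section Analytic

variable {c α lam : Fin 2 → ℝ} {x t : ℝ}

lemma PolyGrowth.laplaceExp_mul_inv (h : IsMixture c α lam) :
    PolyGrowth fun w => _root_.laplaceExp c α lam (_root_.vline w) * (_root_.vline w)⁻¹ :=
  (PolyGrowth.laplaceExp h).mul PolyGrowth.vline_inv

lemma hasDerivAt_survival_left (h : IsMixture c α lam) (hx : 0 < x) (t : ℝ) :
    HasDerivAt (fun x => survival c α lam x t) (-exitDensity c α lam x t) x := by
  refine (hasDerivAt_bromwich_left h PolyGrowth.vline_inv hx t).congr_deriv ?_
  simp_rw [neg_mul]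
  exact bromwich_neg _ _ _

lemma hasDerivAt_survival_right (h : IsMixture c α lam) (hx : 0 < x) (t : ℝ) :
    HasDerivAt (fun t => survival c α lam x t) (subordinatorDensity c α lam x t) t := by
  have := hasDerivAt_bromwich_right h PolyGrowth.vline_inv hx t
  simp_rw [fun w => mul_inv_cancel₀ (vline_ne_zero w)] at this
  exact this

lemma hasDerivAt_exitDensity_left (h : IsMixture c α lam) (hx : 0 < x) (t : ℝ) :
    HasDerivAt (fun x => exitDensity c α lam x t)
      (-bromwich c α lam (fun w => laplaceExp c α lam (vline w) *
        (laplaceExp c α lam (vline w) * (vline w)⁻¹)) x t) x := by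
  refine (hasDerivAt_bromwich_left h (PolyGrowth.laplaceExp_mul_inv h) hx t).congr_deriv ?_
  simp_rw [neg_mul]
  exact bromwich_neg _ _ _

lemma continuous_survival_right (h : IsMixture c α lam) (hx : 0 < x) :
    Continuous fun t => survival c α lam x t :=
  continuous_bromwich_right h PolyGrowth.vline_inv hx

lemma continuous_subordinatorDensity_right (h : IsMixture c α lam) (hx : 0 < x) :
    Continuous fun t => subordinatorDensity c α lam x t :=
  continuous_bromwich_right h (PolyGrowth.const 1) hx

lemma measurable_survival (h : IsMixture c α lam) :
    Measurable fun p : ℝ × ℝ => survival c α lam p.1 p.2 :=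
  measurable_bromwich h PolyGrowth.vline_inv

lemma measurable_subordinatorDensity (h : IsMixture c α lam) :
    Measurable fun p : ℝ × ℝ => subordinatorDensity c α lam p.1 p.2 :=
  measurable_bromwich h (PolyGrowth.const 1)

lemma measurable_exitDensity (h : IsMixture c α lam) :
    Measurable fun p : ℝ × ℝ => exitDensity c α lam p.1 p.2 :=
  measurable_bromwich h (PolyGrowth.laplaceExp_mul_inv h)

end Analytic

namespace IsMTSS

variable {Ω : Type*} [MeasurableSpace Ω] {P : Measure Ω} [IsProbabilityMeasure P]
  {c α lam : Fin 2 → ℝ} {S : ℝ≥0 → Ω → ℝ} {x t : ℝ}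

lemma survival_of_neg (h : IsMixture c α lam) (hS : IsMTSS c α lam S P) (hx : 0 < x)
    (ht : t < 0) : survival c α lam x t = 0 := hS.bromwich_eq_zero h hx ht

lemma survival_zero (h : IsMixture c α lam) (hS : IsMTSS c α lam S P) (hx : 0 < x) :
    survival c α lam x 0 = 0 :=
  bromwich_zero_of_neg h PolyGrowth.vline_inv hx fun _ ht => hS.bromwich_eq_zero h hx ht

lemma survival_eq (h : IsMixture c α lam) (hS : IsMTSS c α lam S P) (hx : 0 < x) (t : ℝ) :
    survival c α lam x t = P.real {ω | x < firstExit S t ω} :=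
  (hS.measureReal_lt_firstExit h hx t).symm

lemma survival_nonneg (h : IsMixture c α lam) (hS : IsMTSS c α lam S P) (hx : 0 < x) (t : ℝ) :
    0 ≤ survival c α lam x t := by
  rw [hS.survival_eq h hx]
  exact measureReal_nonneg

lemma survival_le_one (h : IsMixture c α lam) (hS : IsMTSS c α lam S P) (hx : 0 < x) (t : ℝ) :
    survival c α lam x t ≤ 1 := by
  rw [hS.survival_eq h hx]
  exact measureReal_le_one

lemma subordinatorDensity_nonneg (h : IsMixture c α lam) (hS : IsMTSS c α lam S P) (hx : 0 < x)
    (t : ℝ) : 0 ≤ subordinatorDensity c α lam x t := by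
  have hm : Monotone fun t => survival c α lam x t := by
    intro a b hab
    lift x to ℝ≥0 using hx.le
    have hx' : 0 < x := by exact_mod_cast hx
    simp only [survival]
    rw [← hS.measureReal_le_eq h hx', ← hS.measureReal_le_eq h hx']
    exact measureReal_mono fun ω (hω : S x ω ≤ a) => hω.trans hab
  rw [← (hasDerivAt_survival_right h hx t).deriv]
  exact hm.deriv_nonneg

lemma exitDensity_nonneg (h : IsMixture c α lam) (hS : IsMTSS c α lam S P) (hx : 0 < x)
    (t : ℝ) : 0 ≤ exitDensity c α lam x t := by
  have hd := (hasDerivAt_survival_left h hx t)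
  have h1 : -exitDensity c α lam x t ≤ 0 := by
    refine hd.hasDerivWithinAt (s := Ioi x) |>.nonpos_of_antitoneOn ?_ ?_
    · rw [accPt_principal_iff_nhdsWithin]
      have : (Ioi x) \ {x} = Ioi x := by
        ext y
        simp only [Set.mem_sdiff, mem_Ioi, mem_singleton_iff, and_iff_left_iff_imp]
        exact fun hy => hy.ne'
      rw [this]
      infer_instance
    · intro a ha b hb hab
      have ha' : 0 < a := hx.trans ha
      have hb' : 0 < b := hx.trans hb
      simp only
      rw [hS.survival_eq h ha', hS.survival_eq h hb']
      exact measureReal_mono fun ω (hω : b < firstExit S t ω) => hab.trans_lt hω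
  linarith

lemma exitDensity_of_neg (h : IsMixture c α lam) (hS : IsMTSS c α lam S P) (hx : 0 < x)
    (ht : t < 0) : exitDensity c α lam x t = 0 := by
  have h1 : HasDerivAt (fun x => survival c α lam x t) 0 x := by
    refine (hasDerivAt_const x (0 : ℝ)).congr_of_eventuallyEq ?_
    filter_upwards [Ioi_mem_nhds hx] with y hy using hS.survival_of_neg h hy ht
  have := (hasDerivAt_survival_left h hx t).unique h1
  linarith

lemma exitDensity_zero (h : IsMixture c α lam) (hS : IsMTSS c α lam S P) (hx : 0 < x) :
    exitDensity c α lam x 0 = 0 :=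
  bromwich_zero_of_neg h (PolyGrowth.laplaceExp_mul_inv h) hx
    fun _ ht => hS.exitDensity_of_neg h hx ht

/-- The fractional equation for the survival function: its right-hand side is the density. -/
lemma sum_shiftedFracDeriv_survival (h : IsMixture c α lam) (hS : IsMTSS c α lam S P)
    (hx : 0 < x) (ht : 0 ≤ t) :
    ∑ i, c i * shiftedFracDeriv (lam i) (α i) (fun r => survival c α lam x r) t
      - (∑ i, c i * lam i ^ α i) * survival c α lam x t = exitDensity c α lam x t :=
  sum_shiftedFracDeriv_bromwich h PolyGrowth.vline_inv hx
    (fun _ ht => hS.bromwich_eq_zero h hx ht) ht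

lemma hasDerivAt_exitDensity (h : IsMixture c α lam) (hS : IsMTSS c α lam S P)
    (hx : 0 < x) (ht : 0 ≤ t) :
    HasDerivAt (fun y => exitDensity c α lam y t)
      (-(∑ i, c i * shiftedFracDeriv (lam i) (α i) (fun r => exitDensity c α lam x r) t)
        + (∑ i, c i * lam i ^ α i) * exitDensity c α lam x t) x := by
  refine (hasDerivAt_exitDensity_left h hx t).congr_deriv ?_
  rw [← sum_shiftedFracDeriv_bromwich h (PolyGrowth.laplaceExp_mul_inv h) hx
    (fun _ ht => hS.exitDensity_of_neg h hx ht) ht]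
  simp only [exitDensity]
  ring

/-- The survival function is the complement of the distribution function of `E(t)`; in
particular it extends right-continuously to `x = 0`. -/
lemma survival_eq_one_sub_cdf (h : IsMixture c α lam) (hS : IsMTSS c α lam S P) (hx : 0 < x)
    (t : ℝ) : survival c α lam x t = 1 - cdf (P.map (firstExit S t)) x := by
  have hm := hS.aemeasurable_firstExit h t
  have := Measure.isProbabilityMeasure_map (μ := P) hm
  rw [hS.survival_eq h hx, cdf_eq_real, ← probReal_compl_eq_one_sub measurableSet_Iic,
    map_measureReal_apply_of_aemeasurable hm measurableSet_Iic.compl]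
  congr 1
  ext ω
  simp

lemma cdf_firstExit_of_nonpos (h : IsMixture c α lam) (hS : IsMTSS c α lam S P) (ht : 0 < t)
    (hx : x ≤ 0) : cdf (P.map (firstExit S t)) x = 0 := by
  have hm := hS.aemeasurable_firstExit h t
  have := Measure.isProbabilityMeasure_map (μ := P) hm
  rw [cdf_eq_real, map_measureReal_apply_of_aemeasurable hm measurableSet_Iic,
    measureReal_eq_zero_iff]
  have h1 : ∀ᵐ ω ∂P, 0 < firstExit S t ω := by
    filter_upwards [hS.ae_isSubordinatorPath h] with ω hω using hω.firstExit_pos ht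
  refine measure_mono_null (fun ω (hω : firstExit S t ω ≤ x) => ?_) (ae_iff.1 h1)
  exact not_lt.2 (hω.trans hx)

lemma tendsto_survival_nhdsGT_zero (h : IsMixture c α lam) (hS : IsMTSS c α lam S P)
    (ht : 0 < t) : Tendsto (fun x => survival c α lam x t) (𝓝[>] 0) (𝓝 1) := by
  have h1 : Tendsto (fun x => 1 - cdf (P.map (firstExit S t)) x) (𝓝[>] 0)
      (𝓝 (1 - cdf (P.map (firstExit S t)) 0)) :=
    (((cdf (P.map (firstExit S t))).right_continuous 0).mono_left
      (nhdsWithin_mono _ Ioi_subset_Ici_self)).const_sub 1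
  rw [hS.cdf_firstExit_of_nonpos h ht le_rfl, sub_zero] at h1
  refine h1.congr' ?_
  filter_upwards [self_mem_nhdsWithin] with x hx using (hS.survival_eq_one_sub_cdf h hx t).symm

lemma integral_exitDensity (h : IsMixture c α lam) (hS : IsMTSS c α lam S P) (hx : 0 ≤ x)
    (t : ℝ) : IntegrableOn (fun y => exitDensity c α lam y t) (Ioi x) ∧
      ∫ y in Ioi x, exitDensity c α lam y t = 1 - cdf (P.map (firstExit S t)) x := by
  have hderiv : ∀ y ∈ Ioi x, HasDerivAt (fun y => 1 - cdf (P.map (firstExit S t)) y)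
      (-exitDensity c α lam y t) y := by
    intro y hy
    have hy0 : 0 < y := hx.trans_lt hy
    refine (hasDerivAt_survival_left h hy0 t).congr_of_eventuallyEq ?_
    filter_upwards [Ioi_mem_nhds hy0] with z hz using (hS.survival_eq_one_sub_cdf h hz t).symm
  have hcont : ContinuousWithinAt (fun y => 1 - cdf (P.map (firstExit S t)) y) (Ici x) x :=
    continuousWithinAt_const.sub ((cdf (P.map (firstExit S t))).right_continuous x)
  have hneg : ∀ y ∈ Ioi x, -exitDensity c α lam y t ≤ 0 := fun y hy =>
    neg_nonpos.2 (hS.exitDensity_nonneg h (hx.trans_lt hy) t)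
  have hlim : Tendsto (fun y => 1 - cdf (P.map (firstExit S t)) y) atTop (𝓝 0) := by
    have := (tendsto_cdf_atTop (P.map (firstExit S t))).const_sub 1
    simpa using this
  have hi := integrableOn_Ioi_deriv_of_nonpos hcont hderiv hneg hlim
  have he := integral_Ioi_of_hasDerivAt_of_nonpos hcont hderiv hneg hlim
  refine ⟨by simpa using hi.neg, ?_⟩
  rw [integral_neg] at he
  linarith

lemma hasLaw_firstExit (h : IsMixture c α lam) (hS : IsMTSS c α lam S P) (ht : 0 < t) :
    HasLaw (firstExit S t) ((volume.restrict (Ioi 0)).withDensity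
      (fun x => ENNReal.ofReal (exitDensity c α lam x t))) P := by
  have hm := hS.aemeasurable_firstExit h t
  have := Measure.isProbabilityMeasure_map (μ := P) hm
  refine ⟨hm, ?_⟩
  set μ := P.map (firstExit S t) with hμ
  set ν := (volume.restrict (Ioi 0)).withDensity
    (fun x => ENNReal.ofReal (exitDensity c α lam x t)) with hν
  have hIoi : ∀ a, 0 ≤ a → ν (Ioi a) = ENNReal.ofReal (1 - cdf μ a) := by
    intro a ha
    rw [hν, withDensity_apply _ measurableSet_Ioi, Measure.restrict_restrict measurableSet_Ioi,
      inter_eq_left.2 (Ioi_subset_Ioi ha), ← (hS.integral_exitDensity h ha t).2,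
      ofReal_integral_eq_lintegral_ofReal (hS.integral_exitDensity h ha t).1]
    filter_upwards [ae_restrict_mem measurableSet_Ioi] with y hy
    exact hS.exitDensity_nonneg h (ha.trans_lt hy) t
  have hIic0 : ∀ a, a ≤ 0 → ν (Iic a) = 0 := by
    intro a ha
    rw [hν, withDensity_apply _ measurableSet_Iic, Measure.restrict_restrict measurableSet_Iic]
    have : Iic a ∩ Ioi 0 = (∅ : Set ℝ) := by
      ext y
      simp only [mem_inter_iff, mem_Iic, mem_Ioi, mem_empty_iff_false, iff_false, not_and, not_lt]
      exact fun hy => hy.trans ha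
    rw [this]
    simp
  have hprob : IsProbabilityMeasure ν := by
    refine ⟨?_⟩
    rw [← Iic_union_Ioi (a := (0 : ℝ)), measure_union (Iic_disjoint_Ioi le_rfl) measurableSet_Ioi,
      hIic0 0 le_rfl, hIoi 0 le_rfl, hS.cdf_firstExit_of_nonpos h ht le_rfl]
    simp
  refine Measure.ext_of_Iic μ ν fun a => ?_
  rcases le_total a 0 with ha | ha
  · rw [hIic0 a ha, ← ofReal_cdf, hS.cdf_firstExit_of_nonpos h ht ha, ENNReal.ofReal_zero]
  · rw [← compl_Ioi, prob_compl_eq_one_sub measurableSet_Ioi, prob_compl_eq_one_sub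
      measurableSet_Ioi, hIoi a ha, ← compl_Iic, prob_compl_eq_one_sub measurableSet_Iic,
      ← ofReal_cdf, ENNReal.ofReal_sub _ (cdf_nonneg μ a), ENNReal.ofReal_one]

lemma hasLaw_firstExit_zero (h : IsMixture c α lam) (hS : IsMTSS c α lam S P) :
    HasLaw (firstExit S 0) (Measure.dirac 0) P := by
  refine (hasLaw_congr (Y := fun _ => (0 : ℝ)) ?_).2 ⟨aemeasurable_const, ?_⟩
  · filter_upwards [hS.ae_isSubordinatorPath h] with ω hω using hω.firstExit_zero
  · simp

lemma integral_mul_exitDensity (h : IsMixture c α lam) (hS : IsMTSS c α lam S P) (ht : 0 < t)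
    (ψ : ℝ → ℝ) : ∫ x, ψ x ∂(P.map (firstExit S t)) =
      ∫ x in Ioi 0, ψ x * exitDensity c α lam x t := by
  have hmeas : Measurable fun x => ENNReal.ofReal (exitDensity c α lam x t) :=
    ((measurable_exitDensity h).comp measurable_prodMk_right).ennreal_ofReal
  rw [(hS.hasLaw_firstExit h ht).map_eq, integral_withDensity_eq_integral_toReal_smul hmeas
    (ae_of_all _ fun x => ENNReal.ofReal_lt_top)]
  refine setIntegral_congr_fun measurableSet_Ioi fun x hx => ?_
  simp only [smul_eq_mul]
  rw [ENNReal.toReal_ofReal (hS.exitDensity_nonneg h hx t), mul_comm]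

lemma tendsto_integral_mul_exitDensity (h : IsMixture c α lam) (hS : IsMTSS c α lam S P)
    (ψ : BoundedContinuousFunction ℝ ℝ) :
    Tendsto (fun t => ∫ x in Ioi 0, ψ x * exitDensity c α lam x t) (𝓝[>] 0) (𝓝 (ψ 0)) := by
  have h1 : Tendsto (fun t => ∫ ω, ψ (firstExit S t ω) ∂P) (𝓝[>] 0) (𝓝 (∫ _, ψ 0 ∂P)) := by
    refine tendsto_integral_filter_of_dominated_convergence (fun _ => ‖ψ‖) ?_ ?_ ?_ ?_
    · exact Eventually.of_forall fun t => (ψ.continuous.measurable.comp_aemeasurable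
        (hS.aemeasurable_firstExit h t)).aestronglyMeasurable
    · exact Eventually.of_forall fun t => ae_of_all _ fun ω => ψ.norm_coe_le_norm _
    · exact integrable_const _
    · filter_upwards [hS.ae_isSubordinatorPath h] with ω hω
      exact (ψ.continuous.tendsto 0).comp hω.tendsto_firstExit
  simp only [integral_const, probReal_univ, one_smul] at h1
  refine h1.congr' ?_
  filter_upwards [self_mem_nhdsWithin] with t ht
  rw [← hS.integral_mul_exitDensity h ht, integral_map (hS.aemeasurable_firstExit h t)
    ψ.continuous.aestronglyMeasurable]

end IsMTSS

/-! ### Estimates as `x ↓ 0` by integration by parts along the line -/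

/-- The derivative `φ'` of the Laplace exponent along the line. -/
noncomputable def laplaceExpDeriv (c α lam : Fin 2 → ℝ) (w : ℝ) : ℂ :=
  ∑ i, (c i : ℂ) * (α i * (vline w + lam i) ^ ((α i - 1 : ℝ) : ℂ))

/-- The second derivative `φ''` of the Laplace exponent along the line. -/
noncomputable def laplaceExpDeriv₂ (c α lam : Fin 2 → ℝ) (w : ℝ) : ℂ :=
  ∑ i, (c i : ℂ) * (α i * ((α i - 1 : ℝ) * (vline w + lam i) ^ ((α i - 2 : ℝ) : ℂ)))

section Derivatives

variable {c α lam : Fin 2 → ℝ}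

lemma hasDerivAt_laplaceExp_vline (h : IsMixture c α lam) (w : ℝ) :
    HasDerivAt (fun w => laplaceExp c α lam (vline w))
      (2 * Real.pi * Complex.I * laplaceExpDeriv c α lam w) w := by
  have h1 := h.differentiableAt_laplaceExp (z := vline w) (by simp)
  refine (h1.comp_of_eq w (hasDerivAt_vline w) rfl).congr_deriv ?_
  simp only [laplaceExpDeriv]
  push_cast
  ring

lemma hasDerivAt_laplaceExpDeriv (h : IsMixture c α lam) (w : ℝ) :
    HasDerivAt (laplaceExpDeriv c α lam)
      (2 * Real.pi * Complex.I * laplaceExpDeriv₂ c α lam w) w := by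
  unfold laplaceExpDeriv laplaceExpDeriv₂
  rw [Finset.mul_sum]
  refine HasDerivAt.fun_sum fun i _ => ?_
  have h1 : HasDerivAt (fun w => vline w + lam i) (2 * Real.pi * Complex.I) w :=
    (hasDerivAt_vline w).add_const _
  have h2 : HasDerivAt (fun z : ℂ => z ^ ((α i - 1 : ℝ) : ℂ))
      (((α i - 1 : ℝ) : ℂ) * (vline w + lam i) ^ ((α i - 2 : ℝ) : ℂ)) (vline w + lam i) := by
    have := (hasDerivAt_id (vline w + lam i)).cpow_const (c := ((α i - 1 : ℝ) : ℂ))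
      (vline_add_mem_slitPlane w (h.lam_nonneg i))
    refine this.congr_deriv ?_
    simp only [id]
    rw [show (((α i - 2 : ℝ)) : ℂ) = ((α i - 1 : ℝ) : ℂ) - 1 by push_cast; ring]
    ring
  refine (((h2.comp w h1).const_mul (α i : ℂ)).const_mul (c i : ℂ)).congr_deriv ?_
  ring

lemma PolyGrowth.laplaceExpDeriv (h : IsMixture c α lam) :
    PolyGrowth (laplaceExpDeriv c α lam) := by
  have hp : ∀ i, PolyGrowth fun w => (c i : ℂ) *
      (α i * (_root_.vline w + lam i) ^ ((α i - 1 : ℝ) : ℂ)) := fun i =>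
    (const _).mul ((const _).mul (vline_add_cpow (h.lam_nonneg i) (by linarith [(h.α_mem i).2])))
  have := (hp 0).add (hp 1)
  convert this using 2 with w
  simp only [_root_.laplaceExpDeriv, Fin.sum_univ_two]

lemma PolyGrowth.laplaceExpDeriv₂ (h : IsMixture c α lam) :
    PolyGrowth (laplaceExpDeriv₂ c α lam) := by
  have hp : ∀ i, PolyGrowth fun w => (c i : ℂ) *
      (α i * ((α i - 1 : ℝ) * (_root_.vline w + lam i) ^ ((α i - 2 : ℝ) : ℂ))) := fun i =>
    (const _).mul ((const _).mul ((const _).mul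
      (vline_add_cpow (h.lam_nonneg i) (by linarith [(h.α_mem i).2]))))
  have := (hp 0).add (hp 1)
  convert this using 2 with w
  simp only [_root_.laplaceExpDeriv₂, Fin.sum_univ_two]

lemma norm_vline_add_rpow_sub_le {l : ℝ} (hl : 0 ≤ l) (a : ℝ) {b : ℝ} (hb : 0 ≤ b) (w : ℝ) :
    ‖vline w + l‖ ^ (a - b) ≤ ‖vline w + l‖ ^ a / ‖vline w‖ ^ b := by
  have h1 := one_le_norm_vline w
  have h2 := one_le_norm_vline_add w hl
  rw [Real.rpow_sub (by linarith)]
  gcongr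
  exact norm_vline_le_add w hl

lemma norm_laplaceExpDeriv_le (h : IsMixture c α lam) (w : ℝ) :
    ‖laplaceExpDeriv c α lam w‖ ≤ growth c α lam w / ‖vline w‖ := by
  unfold laplaceExpDeriv growth
  rw [Finset.sum_div]
  refine (norm_sum_le _ _).trans (Finset.sum_le_sum fun i _ => ?_)
  rw [norm_mul, norm_mul, Complex.norm_cpow_real, Complex.norm_real, Complex.norm_real,
    Real.norm_of_nonneg (h.c_nonneg i), Real.norm_of_nonneg (h.α_mem i).1.le, mul_div_assoc]
  refine mul_le_mul_of_nonneg_left ?_ (h.c_nonneg i)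
  have h1 := norm_vline_add_rpow_sub_le (h.lam_nonneg i) (α i) zero_le_one w
  rw [Real.rpow_one] at h1
  refine le_trans ?_ h1
  exact mul_le_of_le_one_left (by positivity) (h.α_mem i).2.le

lemma norm_laplaceExpDeriv₂_le (h : IsMixture c α lam) (w : ℝ) :
    ‖laplaceExpDeriv₂ c α lam w‖ ≤ growth c α lam w / ‖vline w‖ ^ 2 := by
  unfold laplaceExpDeriv₂ growth
  rw [Finset.sum_div]
  refine (norm_sum_le _ _).trans (Finset.sum_le_sum fun i _ => ?_)
  have hα := h.α_mem i
  rw [norm_mul, norm_mul, norm_mul, Complex.norm_cpow_real, Complex.norm_real, Complex.norm_real,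
    Complex.norm_real, Real.norm_of_nonneg (h.c_nonneg i), Real.norm_of_nonneg hα.1.le,
    mul_div_assoc, Real.norm_eq_abs, abs_of_neg (by linarith [hα.2])]
  refine mul_le_mul_of_nonneg_left ?_ (h.c_nonneg i)
  have h1 := norm_vline_add_rpow_sub_le (h.lam_nonneg i) (α i) zero_le_two w
  rw [Real.rpow_two] at h1
  refine le_trans ?_ h1
  rw [← mul_assoc]
  exact mul_le_of_le_one_left (by positivity) (by nlinarith [hα.1, hα.2])

/-- Integration by parts along the line: a factor `t` is traded for a derivative of the symbol
`Q e^{-x φ}`. -/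
lemma mul_bromwich_eq (h : IsMixture c α lam) {Q q : ℝ → ℂ} (hQ : PolyGrowth Q)
    (hq : PolyGrowth q) (hd : ∀ w, HasDerivAt Q (2 * Real.pi * Complex.I * q w) w) {x : ℝ}
    (hx : 0 < x) (t : ℝ) :
    t * bromwich c α lam Q x t =
      -bromwich c α lam (fun w => q w + -((x : ℂ) * (laplaceExpDeriv c α lam w * Q w))) x t := by
  have hR : PolyGrowth fun w => q w + -((x : ℂ) * (laplaceExpDeriv c α lam w * Q w)) :=
    hq.add ((PolyGrowth.const _).mul ((PolyGrowth.laplaceExpDeriv h).mul hQ)).neg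
  have hK : ∀ w, HasDerivAt (fun w => bromwichKernel c α lam Q x t w)
      (2 * Real.pi * Complex.I * (t * bromwichKernel c α lam Q x t w +
        bromwichKernel c α lam
          (fun w => q w + -((x : ℂ) * (laplaceExpDeriv c α lam w * Q w))) x t w)) w := by
    intro w
    have h1 := ((hasDerivAt_vline w).mul_const (t : ℂ)).cexp
    have h2 := (((hasDerivAt_laplaceExp_vline h w).const_mul (x : ℂ)).fun_neg).cexp
    refine ((h1.fun_mul (hd w)).fun_mul h2).congr_deriv ?_
    simp only [bromwichKernel]
    ring
  have hi1 := integrable_bromwichKernel h hQ hx t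
  have hi2 := integrable_bromwichKernel h hR hx t
  have hzero := integral_eq_zero_of_hasDerivAt_of_integrable hK
    (((hi1.const_mul (t : ℂ)).add hi2).const_mul _) hi1
  rw [integral_const_mul, integral_add (hi1.const_mul _) hi2, integral_const_mul] at hzero
  have hne : (2 * Real.pi * Complex.I : ℂ) ≠ 0 := by
    simp [Real.pi_ne_zero, Complex.I_ne_zero]
  have h3 := (mul_eq_zero.1 hzero).resolve_left hne
  have h4 := congrArg Complex.re h3
  rw [Complex.add_re, Complex.re_ofReal_mul, Complex.zero_re] at h4
  unfold bromwich
  linarith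

lemma integrable_norm_vline_rpow {p : ℝ} (hp : p < -1) : Integrable fun w => ‖vline w‖ ^ p := by
  have h1 := integrable_one_add_norm (E := ℝ) (μ := volume) (r := -p) (by simp; linarith)
  refine (h1.const_mul (2 ^ (-p))).mono' ?_ (ae_of_all _ fun w => ?_)
  · exact (continuous_vline.norm.rpow_const fun w =>
      Or.inl (norm_ne_zero_iff.2 (vline_ne_zero w))).aestronglyMeasurable
  · have h2 : (1 + |w|) / 2 ≤ ‖vline w‖ := by
      linarith [one_le_norm_vline w, abs_le_norm_vline w]
    rw [Real.norm_of_nonneg (by positivity), neg_neg, Real.norm_eq_abs, Real.rpow_neg two_pos.le,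
      mul_comm, ← div_eq_mul_inv, ← Real.div_rpow (by positivity) two_pos.le]
    exact Real.rpow_le_rpow_of_nonpos (by positivity) h2 (by linarith)

lemma rpow_mul_one_add_mul_exp_le {k θ y : ℝ} (hk : 0 < k) (hθ0 : 0 ≤ θ) (hθ1 : θ ≤ 1)
    (hy : 0 ≤ y) : y ^ θ * ((1 + y) * Real.exp (-(k * y))) ≤ ((min 1 (k / 2)) ^ 2)⁻¹ := by
  set d := min 1 (k / 2) with hd
  have hd0 : 0 < d := lt_min one_pos (by linarith)
  have h1 : y ^ θ ≤ 1 + y := by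
    calc y ^ θ ≤ (1 + y) ^ θ := Real.rpow_le_rpow hy (by linarith) hθ0
      _ ≤ (1 + y) ^ (1 : ℝ) := Real.rpow_le_rpow_of_exponent_le (by linarith) hθ1
      _ = 1 + y := Real.rpow_one _
  have h2 : d * (1 + y) ≤ Real.exp (k / 2 * y) := by
    have := Real.add_one_le_exp (k / 2 * y)
    have e1 : d ≤ 1 := min_le_left _ _
    have e2 : d ≤ k / 2 := min_le_right _ _
    nlinarith
  have h3 : d ^ 2 * ((1 + y) * (1 + y)) ≤ Real.exp (k * y) := by
    have : Real.exp (k * y) = Real.exp (k / 2 * y) * Real.exp (k / 2 * y) := by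
      rw [← Real.exp_add]; ring_nf
    rw [this]
    calc d ^ 2 * ((1 + y) * (1 + y)) = (d * (1 + y)) * (d * (1 + y)) := by ring
      _ ≤ _ := mul_le_mul h2 h2 (by positivity) (Real.exp_pos _).le
  rw [Real.exp_neg, ← div_eq_mul_inv, ← mul_div_assoc, div_le_iff₀ (Real.exp_pos _),
    ← div_eq_inv_mul, le_div_iff₀ (by positivity)]
  calc y ^ θ * (1 + y) * d ^ 2 ≤ (1 + y) * (1 + y) * d ^ 2 := by gcongr
    _ ≤ _ := by linarith

/-- A Bromwich integral is bounded by `e^t x^{-θ}` near `x = 0` when its symbol is bounded by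
`(1 + x m) m ^ b / |z| ^ 2`, `m` the growth rate of the Laplace exponent, and `(b - θ) a < 1` for
a bound `a` of the growth exponents. -/
lemma exists_bromwich_le (h : IsMixture c α lam) (X : ℝ) {a Cm θ b : ℝ}
    (ha : ∀ w, growth c α lam w ≤ Cm * ‖vline w‖ ^ a)
    (hθ0 : 0 ≤ θ) (hθ1 : θ ≤ 1) (hθb : θ ≤ b) (hab : a * (b - θ) < 1) :
    ∃ C : ℝ, 0 ≤ C ∧ ∀ (R : ℝ → ℂ) (A x t : ℝ), 0 ≤ A → 0 < x → x ≤ X →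
      (∀ w, ‖R w‖ ≤ A * ((1 + x * growth c α lam w) *
        (growth c α lam w ^ b / ‖vline w‖ ^ 2))) →
      |bromwich c α lam R x t| ≤ A * C * Real.exp t * x ^ (-θ) := by
  obtain ⟨k, hk, hre⟩ := h.exists_re_laplaceExp_ge
  have hCm : 0 ≤ Cm := by
    have h1 := h.one_le_growth 0
    have h2 := ha 0
    have h3 : 0 ≤ ‖vline 0‖ ^ a := by positivity
    by_contra! hcon
    nlinarith
  have hg := (integrable_norm_vline_rpow (p := a * (b - θ) - 2) (by linarith)).const_mul
    (Cm ^ (b - θ))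
  set D := ((min 1 (k / 2)) ^ 2)⁻¹ with hD
  have hD0 : 0 ≤ D := by positivity
  refine ⟨Real.exp (X * IsMixture.killing c α lam) * D *
    ∫ w, Cm ^ (b - θ) * ‖vline w‖ ^ (a * (b - θ) - 2), ?_, ?_⟩
  · have : 0 ≤ ∫ w, Cm ^ (b - θ) * ‖vline w‖ ^ (a * (b - θ) - 2) :=
      integral_nonneg fun w => by positivity
    positivity
  intro R A x t hA hx hxX hR
  have hbound : ∀ w, ‖bromwichKernel c α lam R x t w‖ ≤
      A * Real.exp t * Real.exp (X * IsMixture.killing c α lam) * D * x ^ (-θ) *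
        (Cm ^ (b - θ) * ‖vline w‖ ^ (a * (b - θ) - 2)) := by
    intro w
    rw [norm_bromwichKernel]
    set m := growth c α lam w with hm
    have hm1 : 1 ≤ m := h.one_le_growth w
    have hz := one_le_norm_vline w
    have hxm : 0 < x * m := by positivity
    have e1 : Real.exp (-(x * (laplaceExp c α lam (vline w)).re)) ≤
        Real.exp (X * IsMixture.killing c α lam) * Real.exp (-(k * (x * m))) := by
      rw [← Real.exp_add]
      apply Real.exp_le_exp.2
      have a1 := mul_le_mul_of_nonneg_left (hre w) hx.le
      have a2 := mul_le_mul_of_nonneg_right hxX h.killing_nonneg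
      nlinarith
    have e2 := rpow_mul_one_add_mul_exp_le hk hθ0 hθ1 hxm.le
    have e3 : (1 + x * m) * Real.exp (-(k * (x * m))) ≤ D * (x ^ (-θ) * m ^ (-θ)) := by
      rw [← Real.mul_rpow hx.le (by linarith), Real.rpow_neg hxm.le, ← div_eq_mul_inv,
        le_div_iff₀ (by positivity), mul_comm]
      exact e2
    have e4 : m ^ (-θ) * (m ^ b / ‖vline w‖ ^ 2) ≤
        Cm ^ (b - θ) * ‖vline w‖ ^ (a * (b - θ) - 2) := by
      have b1 : m ^ (-θ) * m ^ b = m ^ (b - θ) := by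
        rw [← Real.rpow_add (by linarith)]; ring_nf
      have b2 : m ^ (b - θ) ≤ Cm ^ (b - θ) * ‖vline w‖ ^ (a * (b - θ)) := by
        rw [Real.rpow_mul (norm_nonneg _), ← Real.mul_rpow hCm (by positivity)]
        exact Real.rpow_le_rpow (by linarith) (ha w) (by linarith)
      rw [← mul_div_assoc, b1, Real.rpow_sub (by linarith : 0 < ‖vline w‖), Real.rpow_two,
        ← mul_div_assoc]
      gcongr
    calc Real.exp t * ‖R w‖ * Real.exp (-(x * (laplaceExp c α lam (vline w)).re))
        ≤ Real.exp t * (A * ((1 + x * m) * (m ^ b / ‖vline w‖ ^ 2))) *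
          (Real.exp (X * IsMixture.killing c α lam) * Real.exp (-(k * (x * m)))) := by
          gcongr
          exact hR w
      _ = A * Real.exp t * Real.exp (X * IsMixture.killing c α lam) *
          (((1 + x * m) * Real.exp (-(k * (x * m)))) * (m ^ b / ‖vline w‖ ^ 2)) := by ring
      _ ≤ A * Real.exp t * Real.exp (X * IsMixture.killing c α lam) *
          ((D * (x ^ (-θ) * m ^ (-θ))) * (m ^ b / ‖vline w‖ ^ 2)) := by gcongr
      _ = A * Real.exp t * Real.exp (X * IsMixture.killing c α lam) * D * x ^ (-θ) *
          (m ^ (-θ) * (m ^ b / ‖vline w‖ ^ 2)) := by ring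
      _ ≤ _ := by gcongr
  calc |bromwich c α lam R x t| ≤ ‖∫ w, bromwichKernel c α lam R x t w‖ :=
        Complex.abs_re_le_norm _
    _ ≤ ∫ w, A * Real.exp t * Real.exp (X * IsMixture.killing c α lam) * D * x ^ (-θ) *
        (Cm ^ (b - θ) * ‖vline w‖ ^ (a * (b - θ) - 2)) :=
        norm_integral_le_of_norm_le (hg.const_mul _) (ae_of_all _ hbound)
    _ = _ := by rw [integral_const_mul]; ring

/-- The density of `S(x)` at `t > 0` is of order `x` as `x ↓ 0`. -/
lemma exists_subordinatorDensity_le (h : IsMixture c α lam) (X : ℝ) :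
    ∃ C : ℝ, 0 ≤ C ∧ ∀ x t : ℝ, 0 < x → x ≤ X → 0 < t →
      subordinatorDensity c α lam x t ≤ C * Real.exp t * x / t ^ 2 := by
  obtain ⟨Cm, -, a, ha, hgr⟩ := h.exists_growth_le
  obtain ⟨C, hC0, hC⟩ := exists_bromwich_le h X (θ := 0) (b := 1) hgr le_rfl zero_le_one
    zero_le_one (by linarith [ha.2])
  refine ⟨C, hC0, fun x t hx hxX ht => ?_⟩
  have h1 : t * subordinatorDensity c α lam x t =
      x * bromwich c α lam (laplaceExpDeriv c α lam) x t := by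
    unfold subordinatorDensity
    rw [mul_bromwich_eq h (PolyGrowth.const 1) (PolyGrowth.const 0)
      (fun w => by simpa using hasDerivAt_const w (1 : ℂ)) hx, ← bromwich_real_mul, ← bromwich_neg]
    congr 1
    ext w
    ring
  have h2 := mul_bromwich_eq h (PolyGrowth.laplaceExpDeriv h) (PolyGrowth.laplaceExpDeriv₂ h)
    (hasDerivAt_laplaceExpDeriv h) hx t
  have h3 := hC (fun w => laplaceExpDeriv₂ c α lam w +
    -((x : ℂ) * (laplaceExpDeriv c α lam w * laplaceExpDeriv c α lam w))) 1 x t zero_le_one hx hxX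
    (fun w => by
      set m := growth c α lam w
      have hm1 : 1 ≤ m := h.one_le_growth w
      have hz := one_le_norm_vline w
      have b1 := norm_laplaceExpDeriv_le h w
      have b2 := norm_laplaceExpDeriv₂_le h w
      refine (norm_add_le _ _).trans ?_
      rw [norm_neg, norm_mul, norm_mul, Complex.norm_real, Real.norm_of_nonneg hx.le, one_mul,
        Real.rpow_one]
      calc ‖laplaceExpDeriv₂ c α lam w‖
            + x * (‖laplaceExpDeriv c α lam w‖ * ‖laplaceExpDeriv c α lam w‖)
          ≤ m / ‖vline w‖ ^ 2 + x * (m / ‖vline w‖ * (m / ‖vline w‖)) := by gcongr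
        _ = (1 + x * m) * (m / ‖vline w‖ ^ 2) := by field_simp)
  rw [le_div_iff₀ (by positivity)]
  have h4 : subordinatorDensity c α lam x t * t ^ 2 =
      x * (t * bromwich c α lam (laplaceExpDeriv c α lam) x t) := by
    linear_combination t * h1
  rw [h4, h2]
  have h5 := (neg_le_abs _).trans h3
  rw [neg_zero, Real.rpow_zero, mul_one, one_mul] at h5
  calc _ ≤ x * (C * Real.exp t) := mul_le_mul_of_nonneg_left h5 hx.le
    _ = _ := by ring

/-- The `x`-derivative of the density of `E(t)` has an integrable singularity at `x = 0`. -/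
lemma exists_abs_deriv_exitDensity_le (h : IsMixture c α lam) (X : ℝ) {t : ℝ} (ht : 0 < t) :
    ∃ C θ : ℝ, θ < 1 ∧ ∀ x : ℝ, 0 < x → x ≤ X →
      |deriv (fun y => exitDensity c α lam y t) x| ≤ C * x ^ (-θ) := by
  obtain ⟨Cm, -, a, ha, hgr⟩ := h.exists_growth_le
  -- `a (2 - θ) < 1` for `θ = (1 + a) / 2`, since `(1 - a) (2 - a) > 0`
  obtain ⟨C, hC0, hC⟩ := exists_bromwich_le h X (θ := (1 + a) / 2) (b := 2) hgr
    (by linarith [ha.1]) (by linarith [ha.2]) (by linarith [ha.2]) (by nlinarith [ha.1, ha.2])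
  set A := 1 + IsMixture.killing c α lam with hA
  have hA1 : 1 ≤ A := by linarith [h.killing_nonneg]
  refine ⟨3 * A ^ 2 * C * Real.exp t / t, (1 + a) / 2, by linarith [ha.2], fun x hx hxX => ?_⟩
  rw [(hasDerivAt_exitDensity_left h hx t).deriv, abs_neg]
  set φ : ℝ → ℂ := fun w => laplaceExp c α lam (vline w) with hφ
  set q : ℝ → ℂ := fun w => laplaceExpDeriv c α lam w * (φ w * (vline w)⁻¹) +
    φ w * (laplaceExpDeriv c α lam w * (vline w)⁻¹ + φ w * -((vline w)⁻¹ * (vline w)⁻¹)) with hq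
  have hφp : PolyGrowth φ := PolyGrowth.laplaceExp h
  have hinv : PolyGrowth fun w => (vline w)⁻¹ := PolyGrowth.vline_inv
  have hqp : PolyGrowth q :=
    ((PolyGrowth.laplaceExpDeriv h).mul (hφp.mul hinv)).add
      (hφp.mul (((PolyGrowth.laplaceExpDeriv h).mul hinv).add (hφp.mul (hinv.mul hinv).neg)))
  have hd : ∀ w, HasDerivAt (fun w => φ w * (φ w * (vline w)⁻¹))
      (2 * Real.pi * Complex.I * q w) w := by
    intro w
    have d1 := hasDerivAt_laplaceExp_vline h w
    have d2 := (hasDerivAt_vline w).fun_inv (vline_ne_zero w)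
    refine (d1.mul (d1.mul d2)).congr_deriv ?_
    have := vline_ne_zero w
    simp only [hq, hφ, Pi.mul_apply]
    field_simp
  have h2 := mul_bromwich_eq h (hφp.mul (hφp.mul hinv)) hqp hd hx t
  have h3 := hC (fun w => q w + -((x : ℂ) * (laplaceExpDeriv c α lam w *
    (φ w * (φ w * (vline w)⁻¹))))) (3 * A ^ 2) x t (by positivity) hx hxX
    (fun w => by
      set m := growth c α lam w
      have hm1 : 1 ≤ m := h.one_le_growth w
      have hz := one_le_norm_vline w
      have b1 := norm_laplaceExpDeriv_le h w
      have b2 : ‖φ w‖ ≤ A * m := h.norm_laplaceExp_le w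
      have c1 : ‖q w‖ ≤ m / ‖vline w‖ * (A * m * ‖vline w‖⁻¹) + A * m *
          (m / ‖vline w‖ * ‖vline w‖⁻¹ + A * m * (‖vline w‖⁻¹ * ‖vline w‖⁻¹)) := by
        refine (norm_add_le _ _).trans ?_
        simp only [norm_mul, norm_inv]
        gcongr
        refine (norm_add_le _ _).trans ?_
        simp only [norm_mul, norm_inv, norm_neg]
        gcongr
      refine (norm_add_le _ _).trans ?_
      simp only [norm_neg, norm_mul, norm_inv, Complex.norm_real, Real.norm_of_nonneg hx.le]
      rw [Real.rpow_two]
      calc ‖q w‖ + x * (‖laplaceExpDeriv c α lam w‖ * (‖φ w‖ * (‖φ w‖ * ‖vline w‖⁻¹)))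
          ≤ (m / ‖vline w‖ * (A * m * ‖vline w‖⁻¹) + A * m *
          (m / ‖vline w‖ * ‖vline w‖⁻¹ + A * m * (‖vline w‖⁻¹ * ‖vline w‖⁻¹))) +
            x * (m / ‖vline w‖ * (A * m * (A * m * ‖vline w‖⁻¹))) := by gcongr
        _ = (2 * A + A ^ 2 + A ^ 2 * (x * m)) * (m ^ 2 / ‖vline w‖ ^ 2) := by
            field_simp
            ring
        _ ≤ (3 * A ^ 2 * (1 + x * m)) * (m ^ 2 / ‖vline w‖ ^ 2) := by
            have hxm : 0 ≤ x * m := by positivity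
            gcongr
            nlinarith [mul_nonneg (sq_nonneg A) hxm]
        _ = _ := by ring)
  have h4 : |t * bromwich c α lam (fun w => φ w * (φ w * (vline w)⁻¹)) x t| ≤
      3 * A ^ 2 * C * Real.exp t * x ^ (-((1 + a) / 2)) := by
    rw [h2, abs_neg]
    exact h3
  rw [abs_mul, abs_of_pos ht] at h4
  rw [div_mul_eq_mul_div, le_div_iff₀ ht, mul_comm]
  exact h4

end Derivatives

/-! ### Behaviour of the fractional derivatives of the survival function as `x ↓ 0` -/

lemma integrableOn_sub_rpow {ν : ℝ} (hν : ν < 1) {t : ℝ} (ht : 0 ≤ t) :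
    IntegrableOn (fun τ : ℝ => (t - τ) ^ (-ν)) (Ioc 0 t) :=
  (intervalIntegrable_iff_integrableOn_Ioc_of_le ht).1 (intervalIntegrable_sub_rpow hν t)

lemma integrableOn_sub_rpow_mul {ν : ℝ} (hν : ν < 1) {t : ℝ} (ht : 0 ≤ t) {g : ℝ → ℝ}
    (hg : Continuous g) : IntegrableOn (fun τ : ℝ => (t - τ) ^ (-ν) * g τ) (Ioc 0 t) :=
  (intervalIntegrable_iff_integrableOn_Ioc_of_le ht).1
    ((intervalIntegrable_sub_rpow hν t).mul_continuousOn hg.continuousOn)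

lemma deriv_exp_mul {g : ℝ → ℝ} {g' τ : ℝ} (hg : HasDerivAt g g' τ) (a : ℝ) :
    deriv (fun r => Real.exp (a * r) * g r) τ = Real.exp (a * τ) * (a * g τ + g') := by
  have h2 : HasDerivAt (fun r => Real.exp (a * r)) (Real.exp (a * τ) * a) τ := by
    simpa using ((hasDerivAt_id τ).const_mul a).exp
  rw [(h2.fun_mul hg).deriv]
  ring

lemma shiftedFracDeriv_eq {g g' : ℝ → ℝ} {t : ℝ} (ht : 0 ≤ t)
    (hg : ∀ τ ∈ Ioc 0 t, HasDerivAt g (g' τ) τ) (a ν : ℝ) :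
    shiftedFracDeriv a ν g t = Real.exp (-a * t) * ((Real.Gamma (1 - ν))⁻¹ *
      ∫ τ in Ioc 0 t, (t - τ) ^ (-ν) * (Real.exp (a * τ) * (a * g τ + g' τ))) := by
  unfold shiftedFracDeriv
  rw [intervalIntegral.integral_of_le ht]
  congr 2
  refine setIntegral_congr_fun measurableSet_Ioc fun τ hτ => ?_
  rw [deriv_exp_mul (hg τ hτ)]

namespace IsMTSS

variable {Ω : Type*} [MeasurableSpace Ω] {P : Measure Ω} [IsProbabilityMeasure P]
  {c α lam : Fin 2 → ℝ} {S : ℝ≥0 → Ω → ℝ} {x t : ℝ}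

lemma integral_subordinatorDensity (h : IsMixture c α lam) (hS : IsMTSS c α lam S P)
    (hx : 0 < x) (ht : 0 ≤ t) :
    ∫ τ in Ioc 0 t, subordinatorDensity c α lam x τ = survival c α lam x t := by
  rw [← intervalIntegral.integral_of_le ht,
    intervalIntegral.integral_eq_sub_of_hasDerivAt
      (fun τ _ => hasDerivAt_survival_right h hx τ)
      ((continuous_subordinatorDensity_right h hx).intervalIntegrable _ _),
    hS.survival_zero h hx, sub_zero]

lemma shiftedFracDeriv_survival_eq (h : IsMixture c α lam) (hx : 0 < x) (ht : 0 ≤ t) (a ν : ℝ) :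
    shiftedFracDeriv a ν (fun r => survival c α lam x r) t =
      Real.exp (-a * t) * ((Real.Gamma (1 - ν))⁻¹ * ∫ τ in Ioc 0 t, (t - τ) ^ (-ν) *
        (Real.exp (a * τ) * (a * survival c α lam x τ + subordinatorDensity c α lam x τ))) :=
  shiftedFracDeriv_eq ht (fun τ _ => hasDerivAt_survival_right h hx τ) a ν

/-- As `x ↓ 0` the law of `S(x)` concentrates at `0`. Since its density tends to `0` uniformly away
from `0`, the test function only has to be integrable, and may be singular at the end point
`t`. -/
lemma tendsto_integral_mul_subordinatorDensity (h : IsMixture c α lam) (hS : IsMTSS c α lam S P)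
    (ht : 0 < t) {g : ℝ → ℝ} (hg : IntegrableOn g (Ioc 0 t)) (hg0 : ContinuousAt g 0)
    (hgf : ∀ x, 0 < x → IntegrableOn (fun τ => g τ * subordinatorDensity c α lam x τ) (Ioc 0 t)) :
    Tendsto (fun x => ∫ τ in Ioc 0 t, g τ * subordinatorDensity c α lam x τ) (𝓝[>] 0)
      (𝓝 (g 0)) := by
  obtain ⟨C, hC0, hC⟩ := exists_subordinatorDensity_le h 1
  have hgc : IntegrableOn (fun τ => |g τ - g 0|) (Ioc 0 t) :=
    (hg.sub (integrable_const (g 0))).abs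
  have hfi : ∀ x, 0 < x → IntegrableOn (fun τ => subordinatorDensity c α lam x τ) (Ioc 0 t) :=
    fun x hx => (intervalIntegrable_iff_integrableOn_Ioc_of_le ht.le).1
      ((continuous_subordinatorDensity_right h hx).intervalIntegrable _ _)
  have hdiff : Tendsto (fun x => ∫ τ in Ioc 0 t, g τ * subordinatorDensity c α lam x τ
      - g 0 * subordinatorDensity c α lam x τ) (𝓝[>] 0) (𝓝 0) := by
    rw [Metric.tendsto_nhds]
    intro ε hε
    obtain ⟨δ, hδ, hgδ⟩ := Metric.continuousAt_iff.1 hg0 (ε / 2) (half_pos hε)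
    set B := ∫ τ in Ioc 0 t, |g τ - g 0| with hB
    set D := C * Real.exp t / δ ^ 2 with hD
    have hD0 : 0 ≤ D := by positivity
    have hlim : Tendsto (fun x : ℝ => ε / 2 + D * x * B) (𝓝[>] 0) (𝓝 (ε / 2 + D * 0 * B)) :=
      (Continuous.tendsto (by fun_prop) 0).mono_left nhdsWithin_le_nhds
    have hlt : ε / 2 + D * 0 * B < ε := by
      rw [mul_zero, zero_mul]
      linarith
    filter_upwards [self_mem_nhdsWithin, hlim.eventually (gt_mem_nhds hlt),
      mem_nhdsWithin_of_mem_nhds (Iio_mem_nhds (zero_lt_one (α := ℝ)))] with x hx hx2 hx1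
    have hx0 : 0 < x := hx
    rw [Real.dist_eq, sub_zero]
    refine lt_of_le_of_lt ?_ hx2
    rw [← Real.norm_eq_abs]
    have hbd : ∀ τ ∈ Ioc 0 t, ‖g τ * subordinatorDensity c α lam x τ
        - g 0 * subordinatorDensity c α lam x τ‖ ≤
        ε / 2 * subordinatorDensity c α lam x τ + D * x * |g τ - g 0| := by
      intro τ hτ
      have hf0 := hS.subordinatorDensity_nonneg h hx0 τ
      rw [← sub_mul, norm_mul, Real.norm_eq_abs, Real.norm_of_nonneg hf0]
      -- near `0` use continuity of `g`, away from `0` smallness of the density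
      rcases lt_or_ge τ δ with hlt | hge
      · have h1 : |g τ - g 0| < ε / 2 := by
          have := @hgδ τ (by rwa [Real.dist_eq, sub_zero, abs_of_pos hτ.1])
          rwa [Real.dist_eq] at this
        have h2 : 0 ≤ D * x * |g τ - g 0| := by positivity
        nlinarith
      · have h1 : subordinatorDensity c α lam x τ ≤ D * x := by
          calc subordinatorDensity c α lam x τ ≤ C * Real.exp τ * x / τ ^ 2 :=
                hC x τ hx0 (le_of_lt hx1) hτ.1
            _ ≤ C * Real.exp t * x / δ ^ 2 := by
                gcongr
                exact hτ.2
            _ = D * x := by rw [hD]; ring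
        have h2 : 0 ≤ ε / 2 * subordinatorDensity c α lam x τ := by positivity
        have h3 := mul_le_mul_of_nonneg_left h1 (abs_nonneg (g τ - g 0))
        linarith
    calc ‖∫ τ in Ioc 0 t, g τ * subordinatorDensity c α lam x τ
          - g 0 * subordinatorDensity c α lam x τ‖
        ≤ ∫ τ in Ioc 0 t, (ε / 2 * subordinatorDensity c α lam x τ + D * x * |g τ - g 0|) := by
          refine norm_integral_le_of_norm_le (((hfi x hx0).const_mul _).add (hgc.const_mul _)) ?_
          filter_upwards [ae_restrict_mem measurableSet_Ioc] with τ hτ using hbd τ hτ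
      _ = ε / 2 * survival c α lam x t + D * x * B := by
          rw [integral_add ((hfi x hx0).const_mul _) (hgc.const_mul _), integral_const_mul,
            integral_const_mul, hS.integral_subordinatorDensity h hx0 ht.le]
      _ ≤ ε / 2 + D * x * B := by
          have := hS.survival_le_one h hx0 t
          nlinarith
  have hsum := hdiff.add ((hS.tendsto_survival_nhdsGT_zero h ht).const_mul (g 0))
  rw [zero_add, mul_one] at hsum
  refine hsum.congr' ?_
  filter_upwards [self_mem_nhdsWithin] with x hx
  have hx0 : 0 < x := hx
  rw [integral_sub (hgf x hx0) ((hfi x hx0).const_mul _), integral_const_mul,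
    hS.integral_subordinatorDensity h hx0 ht.le]
  ring

/-- As `x ↓ 0` the survival function tends to `1` for positive times, but vanishes at time `0`;
the jump contributes the term `t ^ (-ν) e^{-a t} / Γ(1 - ν)`. -/
lemma tendsto_shiftedFracDeriv_survival (h : IsMixture c α lam) (hS : IsMTSS c α lam S P)
    (ht : 0 < t) (a : ℝ) {ν : ℝ} (hν : ν < 1) :
    Tendsto (fun x => shiftedFracDeriv a ν (fun r => survival c α lam x r) t) (𝓝[>] 0)
      (𝓝 (shiftedFracDeriv a ν (fun _ => 1) t +
        t ^ (-ν) * (Real.exp (-a * t) * (Real.Gamma (1 - ν))⁻¹))) := by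
  have hexp : Continuous fun τ => Real.exp (a * τ) := by fun_prop
  have hg : IntegrableOn (fun τ => (t - τ) ^ (-ν) * Real.exp (a * τ)) (Ioc 0 t) :=
    integrableOn_sub_rpow_mul hν ht.le hexp
  have hgF : ∀ x, 0 < x → IntegrableOn
      (fun τ => (t - τ) ^ (-ν) * (Real.exp (a * τ) * survival c α lam x τ)) (Ioc 0 t) :=
    fun x hx => integrableOn_sub_rpow_mul hν ht.le (hexp.mul (continuous_survival_right h hx))
  have hgf : ∀ x, 0 < x → IntegrableOn
      (fun τ => (t - τ) ^ (-ν) * Real.exp (a * τ) * subordinatorDensity c α lam x τ)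
      (Ioc 0 t) := fun x hx => by
    simpa only [mul_assoc, Pi.mul_apply] using integrableOn_sub_rpow_mul hν ht.le
      (hexp.mul (continuous_subordinatorDensity_right h hx))
  have l1 : Tendsto (fun x => ∫ τ in Ioc 0 t, (t - τ) ^ (-ν) *
      (Real.exp (a * τ) * survival c α lam x τ)) (𝓝[>] 0)
      (𝓝 (∫ τ in Ioc 0 t, (t - τ) ^ (-ν) * (Real.exp (a * τ) * 1))) := by
    refine tendsto_integral_filter_of_dominated_convergence
      (fun τ => ‖(t - τ) ^ (-ν) * Real.exp (a * τ)‖) ?_ ?_ hg.norm ?_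
    · filter_upwards [self_mem_nhdsWithin] with x hx using (hgF x hx).aestronglyMeasurable
    · filter_upwards [self_mem_nhdsWithin] with x hx
      refine ae_of_all _ fun τ => ?_
      rw [← mul_assoc, norm_mul]
      refine mul_le_of_le_one_right (norm_nonneg _) ?_
      rw [Real.norm_of_nonneg (hS.survival_nonneg h hx τ)]
      exact hS.survival_le_one h hx τ
    · filter_upwards [ae_restrict_mem measurableSet_Ioc] with τ hτ
      exact ((hS.tendsto_survival_nhdsGT_zero h hτ.1).const_mul _).const_mul _
  have l2 := hS.tendsto_integral_mul_subordinatorDensity h ht hg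
    (ContinuousAt.mul (ContinuousAt.rpow_const (by fun_prop) (Or.inl (by simpa using ht.ne')))
      hexp.continuousAt) hgf
  rw [sub_zero, mul_zero, Real.exp_zero, mul_one] at l2
  have l3 := (((l1.const_mul a).add l2).const_mul ((Real.Gamma (1 - ν))⁻¹)).const_mul
    (Real.exp (-a * t))
  have hone : shiftedFracDeriv a ν (fun _ => 1) t = Real.exp (-a * t) * ((Real.Gamma (1 - ν))⁻¹ *
      (a * ∫ τ in Ioc 0 t, (t - τ) ^ (-ν) * (Real.exp (a * τ) * 1))) := by
    rw [shiftedFracDeriv_eq (g' := fun _ => 0) ht.le (fun τ _ => hasDerivAt_const τ 1),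
      ← integral_const_mul a]
    congr 3
    ext τ
    ring
  have hval : shiftedFracDeriv a ν (fun _ => 1) t +
      t ^ (-ν) * (Real.exp (-a * t) * (Real.Gamma (1 - ν))⁻¹) =
      Real.exp (-a * t) * ((Real.Gamma (1 - ν))⁻¹ *
      (a * (∫ τ in Ioc 0 t, (t - τ) ^ (-ν) * (Real.exp (a * τ) * 1)) + t ^ (-ν))) := by
    rw [hone]
    ring
  rw [hval]
  refine l3.congr' ?_
  filter_upwards [self_mem_nhdsWithin] with x hx
  rw [shiftedFracDeriv_survival_eq h hx ht.le, ← integral_const_mul,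
    ← integral_add ((hgF x hx).const_mul a) (hgf x hx)]
  congr 3
  ext τ
  ring

/-! ### Test functions -/

/-- The expectation `E ψ(E(r))` in terms of the survival function, for a test function supported in
`[-M, M]`. -/
lemma integral_test_eq (h : IsMixture c α lam) (hS : IsMTSS c α lam S P) {ψ : ℝ → ℝ}
    (hψ : ContDiff ℝ 1 ψ) {M : ℝ} (hM : 0 < M) (hψM : ∀ y, M ≤ |y| → ψ y = 0) (r : ℝ) :
    ∫ y, ψ y ∂(P.map (firstExit S r)) =
      ψ 0 + ∫ x in Ioc 0 M, deriv ψ x * survival c α lam x r := by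
  have hm := hS.aemeasurable_firstExit h r
  have hprob := Measure.isProbabilityMeasure_map (μ := P) hm
  set μ := P.map (firstExit S r) with hμ
  have hχ : Continuous (deriv ψ) := hψ.continuous_deriv le_rfl
  have hftc : ∀ y, 0 ≤ y → ∫ x in Ioc 0 y, deriv ψ x = ψ y - ψ 0 := by
    intro y hy
    rw [← intervalIntegral.integral_of_le hy, intervalIntegral.integral_deriv_eq_sub
      (fun x _ => (hψ.differentiable one_ne_zero) x) (hχ.intervalIntegrable _ _)]
  have hrep : ∀ y, 0 ≤ y →
      ψ y = ψ 0 + ∫ x in Ioc 0 M, (Iio y).indicator (deriv ψ) x := by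
    intro y hy
    rw [setIntegral_indicator measurableSet_Iio]
    rcases le_or_gt y M with hyM | hyM
    · have : Ioc 0 M ∩ Iio y = Ioo 0 y := by
        ext x
        simp only [mem_inter_iff, mem_Ioc, mem_Iio, mem_Ioo]
        constructor
        · rintro ⟨⟨h1, _⟩, h3⟩
          exact ⟨h1, h3⟩
        · rintro ⟨h1, h2⟩
          exact ⟨⟨h1, (h2.le.trans hyM)⟩, h2⟩
      rw [this, ← integral_Ioc_eq_integral_Ioo, hftc y hy]
      ring
    · have : Ioc 0 M ∩ Iio y = Ioc 0 M := by
        refine inter_eq_left.2 fun x hx => ?_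
        exact hx.2.trans_lt hyM
      rw [this, hftc M hM.le, hψM M (le_abs_self M), hψM y (hyM.le.trans (le_abs_self y))]
      ring
  have hnn : ∀ᵐ y ∂μ, 0 ≤ y := by
    rw [hμ, ae_map_iff hm measurableSet_Ici]
    exact ae_of_all _ fun ω => IsSubordinatorPath.firstExit_nonneg S r ω
  set f : ℝ → ℝ → ℝ := fun y x => (Iio y).indicator (deriv ψ) x with hf
  have hχi : IntegrableOn (deriv ψ) (Ioc 0 M) := hχ.integrableOn_Ioc
  have hfint : Integrable (Function.uncurry f) (μ.prod (volume.restrict (Ioc 0 M))) := by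
    have hms : MeasurableSet {p : ℝ × ℝ | p.2 < p.1} :=
      measurableSet_lt measurable_snd measurable_fst
    have : Function.uncurry f = {p : ℝ × ℝ | p.2 < p.1}.indicator fun p => deriv ψ p.2 := by
      ext p
      simp [hf, Function.uncurry, indicator]
    rw [this]
    exact (hχi.comp_snd μ).indicator hms
  calc ∫ y, ψ y ∂μ = ∫ y, (ψ 0 + ∫ x in Ioc 0 M, f y x) ∂μ := by
        refine integral_congr_ae ?_
        filter_upwards [hnn] with y hy using hrep y hy
    _ = ψ 0 + ∫ y, (∫ x in Ioc 0 M, f y x) ∂μ := by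
        have hi : Integrable (fun y => ∫ x in Ioc 0 M, f y x) μ := hfint.integral_prod_left
        rw [integral_add (integrable_const _) hi]
        simp
    _ = ψ 0 + ∫ x in Ioc 0 M, (∫ y, f y x ∂μ) := by rw [integral_integral_swap hfint]
    _ = _ := by
        congr 1
        refine setIntegral_congr_fun measurableSet_Ioc fun x hx => ?_
        have e : (fun y => f y x) = (Ioi x).indicator fun _ => deriv ψ x := by
          ext y
          simp [hf, indicator]
        rw [e, integral_indicator measurableSet_Ioi, setIntegral_const, smul_eq_mul,
          hS.survival_eq h hx.1, hμ, map_measureReal_apply_of_aemeasurable hm measurableSet_Ioi,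
          mul_comm]
        rfl

lemma integrableOn_mul_survival (h : IsMixture c α lam) (hS : IsMTSS c α lam S P) {χ : ℝ → ℝ}
    (hχ : Continuous χ) (M r : ℝ) :
    IntegrableOn (fun x => χ x * survival c α lam x r) (Ioc 0 M) := by
  refine (hχ.integrableOn_Ioc (a := 0) (b := M)).norm.mono' ?_ ?_
  · exact hχ.aestronglyMeasurable.mul
      ((measurable_survival h).comp measurable_prodMk_right).aestronglyMeasurable
  · filter_upwards [ae_restrict_mem measurableSet_Ioc] with x hx
    rw [norm_mul]
    refine mul_le_of_le_one_right (norm_nonneg _) ?_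
    rw [Real.norm_of_nonneg (hS.survival_nonneg h hx.1 r)]
    exact hS.survival_le_one h hx.1 r

lemma integrableOn_mul_subordinatorDensity (h : IsMixture c α lam) (hS : IsMTSS c α lam S P)
    {χ : ℝ → ℝ} (hχ : Continuous χ) (M : ℝ) {r : ℝ} (hr : 0 < r) :
    IntegrableOn (fun x => χ x * subordinatorDensity c α lam x r) (Ioc 0 M) := by
  obtain ⟨C, hC0, hC⟩ := exists_subordinatorDensity_le h M
  refine ((hχ.integrableOn_Ioc (a := 0) (b := M)).norm.mul_const
    (C * Real.exp r * M / r ^ 2)).mono' ?_ ?_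
  · exact hχ.aestronglyMeasurable.mul
      ((measurable_subordinatorDensity h).comp measurable_prodMk_right).aestronglyMeasurable
  · filter_upwards [ae_restrict_mem measurableSet_Ioc] with x hx
    rw [norm_mul, Real.norm_of_nonneg (hS.subordinatorDensity_nonneg h hx.1 r)]
    gcongr
    refine (hC x r hx.1 hx.2 hr).trans ?_
    gcongr
    exact hx.2

lemma hasDerivAt_integral_mul_survival (h : IsMixture c α lam) (hS : IsMTSS c α lam S P)
    {χ : ℝ → ℝ} (hχ : Continuous χ) (M : ℝ) {r : ℝ} (hr : 0 < r) :
    HasDerivAt (fun r => ∫ x in Ioc 0 M, χ x * survival c α lam x r)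
      (∫ x in Ioc 0 M, χ x * subordinatorDensity c α lam x r) r := by
  obtain ⟨C, hC0, hC⟩ := exists_subordinatorDensity_le h M
  refine (hasDerivAt_integral_of_dominated_loc_of_deriv_le
    (μ := volume.restrict (Ioc 0 M)) (𝕜 := ℝ)
    (F := fun r x => χ x * survival c α lam x r)
    (F' := fun r x => χ x * subordinatorDensity c α lam x r)
    (bound := fun x => ‖χ x‖ * (C * Real.exp (r + 1) * M / (r / 2) ^ 2))
    (s := Ioo (r / 2) (r + 1)) (Ioo_mem_nhds (by linarith) (by linarith))
    (Eventually.of_forall fun s => (hS.integrableOn_mul_survival h hχ M s).aestronglyMeasurable)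
    (hS.integrableOn_mul_survival h hχ M r)
    (hS.integrableOn_mul_subordinatorDensity h hχ M hr).aestronglyMeasurable ?_
    ((hχ.integrableOn_Ioc (a := 0) (b := M)).norm.mul_const _) ?_).2
  · filter_upwards [ae_restrict_mem measurableSet_Ioc] with x hx s hs
    have hs0 : 0 < s := (half_pos hr).trans hs.1
    rw [norm_mul, Real.norm_of_nonneg (hS.subordinatorDensity_nonneg h hx.1 s)]
    gcongr
    refine (hC x s hx.1 hx.2 hs0).trans ?_
    have h1 := hs.1.le
    have h2 := hs.2.le
    have h3 := hx.2
    have hx0 := hx.1.le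
    have hM0 := hx0.trans hx.2
    gcongr
  · filter_upwards [ae_restrict_mem measurableSet_Ioc] with x hx s hs
    exact (hasDerivAt_survival_right h hx.1 s).const_mul _

lemma continuous_integral_mul_survival (h : IsMixture c α lam) (hS : IsMTSS c α lam S P)
    {χ : ℝ → ℝ} (hχ : Continuous χ) (M : ℝ) :
    Continuous fun r => ∫ x in Ioc 0 M, χ x * survival c α lam x r := by
  refine continuous_of_dominated (bound := fun x => ‖χ x‖)
    (fun r => (hS.integrableOn_mul_survival h hχ M r).aestronglyMeasurable) (fun r => ?_)
    (hχ.integrableOn_Ioc (a := 0) (b := M)).norm ?_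
  · filter_upwards [ae_restrict_mem measurableSet_Ioc] with x hx
    rw [norm_mul]
    refine mul_le_of_le_one_right (norm_nonneg _) ?_
    rw [Real.norm_of_nonneg (hS.survival_nonneg h hx.1 r)]
    exact hS.survival_le_one h hx.1 r
  · filter_upwards [ae_restrict_mem measurableSet_Ioc] with x hx
    exact continuous_const.mul (continuous_survival_right h hx.1)

/-- Integrability in `(x, τ)` that justifies exchanging the fractional integral and the integral
against a test function. For `τ ≤ t / 2` the kernel is bounded and `S(x)` has total mass at most
`1`; for `τ ≥ t / 2` the density of `S(x)` is bounded. -/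
lemma integrable_prod_rpow_mul_subordinatorDensity (h : IsMixture c α lam)
    (hS : IsMTSS c α lam S P) {χ : ℝ → ℝ} (hχ : Continuous χ) (M : ℝ) (ht : 0 < t) {ν : ℝ}
    (hν0 : 0 ≤ ν) (hν : ν < 1) :
    Integrable (fun p : ℝ × ℝ => χ p.1 * ((t - p.2) ^ (-ν) * subordinatorDensity c α lam p.1 p.2))
      ((volume.restrict (Ioc 0 M)).prod (volume.restrict (Ioc 0 t))) := by
  obtain ⟨C, hC0, hC⟩ := exists_subordinatorDensity_le h M
  have hmeas : AEStronglyMeasurable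
      (fun p : ℝ × ℝ => χ p.1 * ((t - p.2) ^ (-ν) * subordinatorDensity c α lam p.1 p.2))
      ((volume.restrict (Ioc 0 M)).prod (volume.restrict (Ioc 0 t))) := by
    refine Measurable.aestronglyMeasurable ?_
    exact (hχ.measurable.comp measurable_fst).mul
      (((measurable_const.sub measurable_snd).pow_const _).mul (measurable_subordinatorDensity h))
  rw [integrable_prod_iff hmeas]
  have hi : ∀ x, 0 < x → IntegrableOn (fun τ => (t - τ) ^ (-ν) * subordinatorDensity c α lam x τ)
      (Ioc 0 t) := fun x hx =>
    integrableOn_sub_rpow_mul hν ht.le (continuous_subordinatorDensity_right h hx)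
  refine ⟨?_, ?_⟩
  · filter_upwards [ae_restrict_mem measurableSet_Ioc] with x hx
    exact (hi x hx.1).const_mul _
  · set B := C * Real.exp t * M / (t / 2) ^ 2 with hB
    set J := (t / 2) ^ (-ν) + B * ∫ τ in Ioc 0 t, (t - τ) ^ (-ν) with hJ
    refine ((hχ.integrableOn_Ioc (a := 0) (b := M)).norm.mul_const J).mono'
      hmeas.norm.integral_prod_right' ?_
    filter_upwards [ae_restrict_mem measurableSet_Ioc] with x hx
    have hfi : IntegrableOn (fun τ => subordinatorDensity c α lam x τ) (Ioc 0 t) :=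
      (intervalIntegrable_iff_integrableOn_Ioc_of_le ht.le).1
        ((continuous_subordinatorDensity_right h hx.1).intervalIntegrable _ _)
    rw [Real.norm_of_nonneg (integral_nonneg fun τ => norm_nonneg _)]
    simp_rw [norm_mul (χ x)]
    rw [integral_const_mul]
    refine mul_le_mul_of_nonneg_left ?_ (norm_nonneg _)
    have hpt : ∀ τ ∈ Ioc 0 t, ‖(t - τ) ^ (-ν) * subordinatorDensity c α lam x τ‖ ≤
        (t / 2) ^ (-ν) * subordinatorDensity c α lam x τ + B * (t - τ) ^ (-ν) := by
      intro τ hτ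
      have hf0 := hS.subordinatorDensity_nonneg h hx.1 τ
      have hr0 : 0 ≤ (t - τ) ^ (-ν) := Real.rpow_nonneg (by linarith [hτ.2]) _
      have hM0 : 0 < M := hx.1.trans_le hx.2
      have hB0 : 0 ≤ B := by positivity
      rw [Real.norm_of_nonneg (mul_nonneg hr0 hf0)]
      rcases le_total τ (t / 2) with h1 | h1
      · have h2 : (t - τ) ^ (-ν) ≤ (t / 2) ^ (-ν) :=
          Real.rpow_le_rpow_of_nonpos (by linarith) (by linarith) (by linarith)
        have := mul_le_mul_of_nonneg_right h2 hf0
        have := mul_nonneg hB0 hr0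
        linarith
      · have h2 : subordinatorDensity c α lam x τ ≤ B := by
          refine (hC x τ hx.1 hx.2 hτ.1).trans ?_
          have h3 := hx.2
          have h4 := hτ.2
          have hx0 := hx.1.le
          rw [hB]
          gcongr
        have := mul_le_mul_of_nonneg_left h2 hr0
        have : 0 ≤ (t / 2) ^ (-ν) * subordinatorDensity c α lam x τ := by positivity
        linarith
    calc ∫ τ in Ioc 0 t, ‖(t - τ) ^ (-ν) * subordinatorDensity c α lam x τ‖
        ≤ ∫ τ in Ioc 0 t,
          ((t / 2) ^ (-ν) * subordinatorDensity c α lam x τ + B * (t - τ) ^ (-ν)) := by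
          refine setIntegral_mono_on (hi x hx.1).norm ?_ measurableSet_Ioc hpt
          exact (hfi.const_mul _).add ((integrableOn_sub_rpow hν ht.le).const_mul _)
      _ = (t / 2) ^ (-ν) * survival c α lam x t + B * ∫ τ in Ioc 0 t, (t - τ) ^ (-ν) := by
          rw [integral_add (hfi.const_mul _) ((integrableOn_sub_rpow hν ht.le).const_mul _),
            integral_const_mul, integral_const_mul, hS.integral_subordinatorDensity h hx.1 ht.le]
      _ ≤ J := by
          have h1 := hS.survival_le_one h hx.1 t
          have h2 : 0 ≤ (t / 2) ^ (-ν) := by positivity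
          rw [hJ]
          nlinarith

/-- The shifted fractional derivative of `r ↦ a₀ + ∫ χ(x) P(E(r) > x) dx` exists, and may be
computed under the integral sign. -/
lemma shiftedFracDeriv_integral_mul_survival (h : IsMixture c α lam) (hS : IsMTSS c α lam S P)
    {χ : ℝ → ℝ} (hχ : Continuous χ) (a₀ M : ℝ) (ht : 0 < t) {a ν : ℝ} (ha : 0 ≤ a) (hν0 : 0 ≤ ν)
    (hν : ν < 1) :
    HasShiftedFracDeriv a ν (fun r => a₀ + ∫ x in Ioc 0 M, χ x * survival c α lam x r) t ∧
    IntegrableOn (fun x => χ x * shiftedFracDeriv a ν (fun r => survival c α lam x r) t)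
      (Ioc 0 M) ∧
    shiftedFracDeriv a ν (fun r => a₀ + ∫ x in Ioc 0 M, χ x * survival c α lam x r) t =
      a₀ * shiftedFracDeriv a ν (fun _ => 1) t +
      ∫ x in Ioc 0 M, χ x * shiftedFracDeriv a ν (fun r => survival c α lam x r) t := by
  set u : ℝ → ℝ := fun r => a₀ + ∫ x in Ioc 0 M, χ x * survival c α lam x r with hu
  set u' : ℝ → ℝ := fun r => ∫ x in Ioc 0 M, χ x * subordinatorDensity c α lam x r with hu'
  have hcont : Continuous u := continuous_const.add (hS.continuous_integral_mul_survival h hχ M)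
  have hder : ∀ τ, 0 < τ → HasDerivAt u (u' τ) τ := fun τ hτ =>
    (hS.hasDerivAt_integral_mul_survival h hχ M hτ).const_add _
  set K : ℝ → ℝ → ℝ := fun x τ => χ x * ((t - τ) ^ (-ν) * (Real.exp (a * τ) *
    (a * survival c α lam x τ + subordinatorDensity c α lam x τ))) with hK
  have hexp : Continuous fun τ => Real.exp (a * τ) := by fun_prop
  have hKint : Integrable (Function.uncurry K)
      ((volume.restrict (Ioc 0 M)).prod (volume.restrict (Ioc 0 t))) := by
    have h1 := hS.integrable_prod_rpow_mul_subordinatorDensity h hχ M ht hν0 hν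
    have h2 : Integrable (fun p : ℝ × ℝ => χ p.1 * (t - p.2) ^ (-ν))
        ((volume.restrict (Ioc 0 M)).prod (volume.restrict (Ioc 0 t))) :=
      Integrable.mul_prod (hχ.integrableOn_Ioc (a := 0) (b := M)) (integrableOn_sub_rpow hν ht.le)
    refine ((h2.norm.const_mul (Real.exp (a * t) * a)).add
      (h1.norm.const_mul (Real.exp (a * t)))).mono' ?_ ?_
    · refine Measurable.aestronglyMeasurable ?_
      exact (hχ.measurable.comp measurable_fst).mul
        (((measurable_const.sub measurable_snd).pow_const _).mul
          ((hexp.measurable.comp measurable_snd).mul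
            ((measurable_const.mul (measurable_survival h)).add
              (measurable_subordinatorDensity h))))
    · have hmem : ∀ᵐ p : ℝ × ℝ ∂((volume.restrict (Ioc 0 M)).prod (volume.restrict (Ioc 0 t))),
          p.1 ∈ Ioc 0 M ∧ p.2 ∈ Ioc 0 t := by
        rw [Measure.prod_restrict]
        filter_upwards [ae_restrict_mem (measurableSet_Ioc.prod measurableSet_Ioc)] with p hp
        exact hp
      filter_upwards [hmem] with p hp
      have hf0 := hS.subordinatorDensity_nonneg h hp.1.1 p.2
      have hF0 := hS.survival_nonneg h hp.1.1 p.2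
      have hF1 := hS.survival_le_one h hp.1.1 p.2
      have hr0 : 0 ≤ (t - p.2) ^ (-ν) := Real.rpow_nonneg (by linarith [hp.2.2]) _
      simp only [Function.uncurry, hK, norm_mul, Pi.add_apply]
      rw [Real.norm_of_nonneg hr0, Real.norm_of_nonneg hf0,
        Real.norm_of_nonneg (Real.exp_pos (a * p.2)).le,
        Real.norm_of_nonneg (by positivity : 0 ≤ a * survival c α lam p.1 p.2 +
          subordinatorDensity c α lam p.1 p.2)]
      have hp2 := hp.2.2
      calc ‖χ p.1‖ * ((t - p.2) ^ (-ν) * (Real.exp (a * p.2) *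
            (a * survival c α lam p.1 p.2 + subordinatorDensity c α lam p.1 p.2)))
          ≤ ‖χ p.1‖ * ((t - p.2) ^ (-ν) * (Real.exp (a * t) *
            (a * 1 + subordinatorDensity c α lam p.1 p.2))) := by gcongr
        _ = _ := by ring
  have hKx : ∀ x, ∫ τ in Ioc 0 t, K x τ = χ x * ∫ τ in Ioc 0 t, (t - τ) ^ (-ν) *
      (Real.exp (a * τ) * (a * survival c α lam x τ + subordinatorDensity c α lam x τ)) :=
    fun x => integral_const_mul _ _
  have hKτ : ∀ τ ∈ Ioc 0 t, (t - τ) ^ (-ν) * (Real.exp (a * τ) * (a * u τ + u' τ)) =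
      a₀ * ((t - τ) ^ (-ν) * (Real.exp (a * τ) * (a * 1 + 0))) + ∫ x in Ioc 0 M, K x τ := by
    intro τ hτ
    have i1 := hS.integrableOn_mul_survival h hχ M τ
    have i2 := hS.integrableOn_mul_subordinatorDensity h hχ M hτ.1
    have : ∫ x in Ioc 0 M, K x τ = (t - τ) ^ (-ν) * (Real.exp (a * τ) *
        (a * (∫ x in Ioc 0 M, χ x * survival c α lam x τ) + u' τ)) := by
      rw [hu', ← integral_const_mul, ← integral_add (i1.const_mul a) i2, ← integral_const_mul,
        ← integral_const_mul]
      congr 1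
      ext x
      simp only [hK]
      ring
    rw [this, hu]
    ring
  have hi0 : IntegrableOn (fun τ => a₀ * ((t - τ) ^ (-ν) * (Real.exp (a * τ) * (a * 1 + 0))))
      (Ioc 0 t) := by
    refine (integrableOn_sub_rpow_mul hν ht.le ?_).const_mul a₀
    fun_prop
  have hiK : IntegrableOn (fun τ => ∫ x in Ioc 0 M, K x τ) (Ioc 0 t) := hKint.integral_prod_right
  refine ⟨⟨hcont.continuousOn, fun τ hτ => (hder τ hτ.1).differentiableAt, ?_, ?_⟩, ?_, ?_⟩
  · rw [intervalIntegrable_iff_integrableOn_Ioc_of_le ht.le]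
    -- the case `ν = 0`, in which the kernel is `1`
    have h1 := (hS.integrable_prod_rpow_mul_subordinatorDensity h hχ M ht le_rfl
      zero_lt_one).integral_prod_right
    refine IntegrableOn.congr_fun h1 (fun τ hτ => ?_) measurableSet_Ioc
    simp only
    rw [(hder τ hτ.1).deriv, hu']
    simp
  · rw [intervalIntegrable_iff_integrableOn_Ioc_of_le ht.le]
    refine IntegrableOn.congr_fun (hi0.add hiK) (fun τ hτ => ?_) measurableSet_Ioc
    simp only [Pi.add_apply]
    rw [deriv_exp_mul (hder τ hτ.1), hKτ τ hτ]
  · have h1 : IntegrableOn (fun x => ∫ τ in Ioc 0 t, K x τ) (Ioc 0 M) := hKint.integral_prod_left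
    refine IntegrableOn.congr_fun
      (h1.const_mul (Real.exp (-a * t) * (Real.Gamma (1 - ν))⁻¹)) (fun x hx => ?_)
      measurableSet_Ioc
    rw [shiftedFracDeriv_survival_eq h hx.1 ht.le, hKx]
    ring
  · rw [shiftedFracDeriv_eq ht.le (fun τ hτ => hder τ hτ.1),
      shiftedFracDeriv_eq (g' := fun _ => 0) ht.le (fun τ _ => hasDerivAt_const τ 1),
      setIntegral_congr_fun measurableSet_Ioc hKτ, integral_add hi0 hiK, integral_const_mul,
      ← integral_integral_swap hKint]
    have h2 : ∫ x in Ioc 0 M, χ x * shiftedFracDeriv a ν (fun r => survival c α lam x r) t =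
        Real.exp (-a * t) * (Real.Gamma (1 - ν))⁻¹ * ∫ x in Ioc 0 M, ∫ τ in Ioc 0 t, K x τ := by
      rw [← integral_const_mul]
      refine setIntegral_congr_fun measurableSet_Ioc fun x hx => ?_
      rw [shiftedFracDeriv_survival_eq h hx.1 ht.le, hKx]
      ring
    rw [h2]
    ring

end IsMTSS

/-! ### The equation on test functions and pointwise -/

lemma ascPochhammer_eval_mul_Gamma {r : ℝ} (hr : 0 < r) (k : ℕ) :
    (ascPochhammer ℝ k).eval r * Real.Gamma r = Real.Gamma (k + r) := by
  induction k with
  | zero => simp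
  | succ k ih =>
    rw [ascPochhammer_succ_eval, mul_right_comm, ih, Nat.cast_succ,
      show (k : ℝ) + 1 + r = (k + r) + 1 by ring, Real.Gamma_add_one (by positivity)]
    ring

/-- The Prabhakar function with `p = 1` and `q = r` is an exponential. -/
lemma prabhakar_one_self {r : ℝ} (hr : 0 < r) (z : ℝ) :
    prabhakar 1 r r z = Real.exp z * (Real.Gamma r)⁻¹ := by
  unfold prabhakar
  rw [Real.exp_eq_exp_ℝ, NormedSpace.exp_eq_tsum_div, ← tsum_mul_right]
  refine tsum_congr fun k => ?_
  have h1 : 0 < Real.Gamma ((k : ℝ) + r) := Real.Gamma_pos_of_pos (by positivity)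
  have h2 : 0 < Real.Gamma r := Real.Gamma_pos_of_pos hr
  have h3 := ascPochhammer_eval_mul_Gamma hr k
  rw [one_mul, div_mul_eq_mul_div, div_eq_iff h1.ne', ← h3]
  field_simp

namespace IsMTSS

variable {Ω : Type*} [MeasurableSpace Ω] {P : Measure Ω} [IsProbabilityMeasure P]
  {c α lam : Fin 2 → ℝ} {S : ℝ≥0 → Ω → ℝ} {x t : ℝ}

/-- The value at `x = 0+` of the density of `E(t)`. -/
lemma tendsto_exitDensity_nhdsGT_zero (h : IsMixture c α lam) (hS : IsMTSS c α lam S P)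
    (ht : 0 < t) : Tendsto (fun x => exitDensity c α lam x t) (𝓝[>] 0)
      (𝓝 (∑ i, c i * (shiftedFracDeriv (lam i) (α i) (fun _ => 1) t +
        t ^ (-α i) * prabhakar 1 (1 - α i) (1 - α i) (-lam i * t)) - ∑ i, c i * lam i ^ α i)) := by
  have h1 : Tendsto (fun x => ∑ i, c i *
      shiftedFracDeriv (lam i) (α i) (fun r => survival c α lam x r) t
      - (∑ i, c i * lam i ^ α i) * survival c α lam x t) (𝓝[>] 0)
      (𝓝 (∑ i, c i * (shiftedFracDeriv (lam i) (α i) (fun _ => 1) t +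
        t ^ (-α i) * (Real.exp (-lam i * t) * (Real.Gamma (1 - α i))⁻¹)) -
        (∑ i, c i * lam i ^ α i) * 1)) :=
    (tendsto_finsetSum _ fun i _ => (hS.tendsto_shiftedFracDeriv_survival h ht (lam i)
      (h.α_mem i).2).const_mul _).sub ((hS.tendsto_survival_nhdsGT_zero h ht).const_mul _)
  rw [mul_one] at h1
  simp_rw [fun i => prabhakar_one_self (sub_pos.2 (h.α_mem i).2) (-lam i * t)]
  refine h1.congr' ?_
  filter_upwards [self_mem_nhdsWithin] with x hx
  exact hS.sum_shiftedFracDeriv_survival h hx ht.le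

/-- Integrability of the `x`-derivative of the density against a test function, and integration by
parts on `(0, ∞)`. -/
lemma integral_deriv_exitDensity_mul (h : IsMixture c α lam) (hS : IsMTSS c α lam S P)
    (ht : 0 < t) {ψ : ℝ → ℝ} (hψ : ContDiff ℝ 1 ψ)
    (hcs : HasCompactSupport ψ) {M : ℝ} (hM : 0 < M)
    (hψM : ∀ y, M ≤ |y| → ψ y = 0) (hψM' : ∀ y, M ≤ |y| → deriv ψ y = 0) {l : ℝ}
    (hl : Tendsto (fun x => exitDensity c α lam x t) (𝓝[>] 0) (𝓝 l)) :
    IntegrableOn (fun x => deriv (fun y => exitDensity c α lam y t) x * ψ x) (Ioi 0) ∧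
    ∫ x in Ioi 0, deriv (fun y => exitDensity c α lam y t) x * ψ x =
      -(l * ψ 0) - ∫ x in Ioc 0 M, deriv ψ x * exitDensity c α lam x t := by
  have hχ : Continuous (deriv ψ) := hψ.continuous_deriv le_rfl
  have hvanish : ∀ x ∈ Ioi (0 : ℝ) \ Ioc 0 M, M ≤ |x| := by
    intro x hx
    have h1 := hx.1
    have h2 := hx.2
    simp only [mem_Ioi, mem_Ioc, not_and, not_le] at h1 h2
    exact (h2 h1).le.trans (le_abs_self x)
  obtain ⟨D, hD⟩ := hψ.continuous.bounded_above_of_compact_support hcs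
  obtain ⟨D', hD'⟩ := hχ.bounded_above_of_compact_support hcs.deriv
  obtain ⟨C, θ, hθ, hC⟩ := exists_abs_deriv_exitDensity_le h M ht
  have hint : IntegrableOn (fun x => deriv (fun y => exitDensity c α lam y t) x * ψ x)
      (Ioi 0) := by
    refine IntegrableOn.of_forall_sdiff_eq_zero (s := Ioc 0 M) ?_ measurableSet_Ioi
      fun x hx => by rw [hψM x (hvanish x hx), mul_zero]
    have hpow : IntegrableOn (fun x : ℝ => x ^ (-θ)) (Ioc 0 M) :=
      (intervalIntegrable_iff_integrableOn_Ioc_of_le hM.le).1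
        (intervalIntegral.intervalIntegrable_rpow' (by linarith))
    refine Integrable.mul_bdd ((hpow.const_mul C).mono'
      (measurable_deriv _).aestronglyMeasurable ?_) hψ.continuous.aestronglyMeasurable
      (ae_of_all _ hD)
    filter_upwards [ae_restrict_mem measurableSet_Ioc] with x hx using hC x hx.1 hx.2
  have hint' : IntegrableOn (fun x => exitDensity c α lam x t * deriv ψ x) (Ioi 0) :=
    ((hS.integral_exitDensity h le_rfl t).1).mul_bdd hχ.aestronglyMeasurable (ae_of_all _ hD')
  refine ⟨hint, ?_⟩
  have hparts := integral_Ioi_mul_deriv_eq_deriv_mul (a := 0) (a' := l * ψ 0) (b' := 0)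
    (u := fun x => exitDensity c α lam x t) (v := ψ)
    (u' := fun x => deriv (fun y => exitDensity c α lam y t) x) (v' := deriv ψ)
    (fun x hx => (hasDerivAt_exitDensity_left h hx t).differentiableAt.hasDerivAt)
    (fun x _ => ((hψ.differentiable one_ne_zero) x).hasDerivAt) hint' hint
    (hl.mul ((hψ.continuous.tendsto 0).mono_left nhdsWithin_le_nhds)) ?_
  · have e : ∫ x in Ioi 0, exitDensity c α lam x t * deriv ψ x =
        ∫ x in Ioc 0 M, deriv ψ x * exitDensity c α lam x t := by
      have hsub : Ioc 0 M ⊆ Ioi (0 : ℝ) := Ioc_subset_Ioi_self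
      rw [setIntegral_eq_of_subset_of_forall_sdiff_eq_zero measurableSet_Ioi hsub
        fun x hx => by rw [hψM' x (hvanish x hx), mul_zero]]
      simp_rw [mul_comm]
    rw [← e, hparts]
    ring
  · refine (tendsto_congr' ?_).2 tendsto_const_nhds
    filter_upwards [eventually_ge_atTop M] with x hx
    simp only [Pi.mul_apply]
    rw [hψM x (hx.trans (le_abs_self x)), mul_zero]

/-- The equation tested against `ψ`, as an identity of distributions on `[0, ∞)`. -/
lemma integral_deriv_exitDensity_mul_eq (h : IsMixture c α lam) (hS : IsMTSS c α lam S P)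
    (ht : 0 < t) {ψ : ℝ → ℝ} (hψ : ContDiff ℝ 1 ψ) (hcs : HasCompactSupport ψ) :
    (∀ i, HasShiftedFracDeriv (lam i) (α i) (fun r => ∫ x, ψ x ∂(P.map (firstExit S r))) t) ∧
    IntegrableOn (fun x => deriv (fun y => exitDensity c α lam y t) x * ψ x) (Ioi 0) ∧
    ∫ x in Ioi 0, deriv (fun y => exitDensity c α lam y t) x * ψ x =
      -(∑ i, c i * shiftedFracDeriv (lam i) (α i)
          (fun r => ∫ x, ψ x ∂(P.map (firstExit S r))) t)
      + (∑ i, c i * lam i ^ α i) * (∫ x, ψ x ∂(P.map (firstExit S t)))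
      - (∑ i, c i * (t ^ (-α i) * prabhakar 1 (1 - α i) (1 - α i) (-lam i * t))) * ψ 0 := by
  have hχ : Continuous (deriv ψ) := hψ.continuous_deriv le_rfl
  obtain ⟨M₁, hM₁, hψM₁⟩ := hcs.exists_pos_le_norm
  obtain ⟨M₂, -, hψM₂⟩ := hcs.deriv.exists_pos_le_norm
  set M := max M₁ M₂
  have hM : 0 < M := lt_max_of_lt_left hM₁
  have hψM : ∀ y, M ≤ |y| → ψ y = 0 := fun y hy => hψM₁ y ((le_max_left _ _).trans hy)
  have hψM' : ∀ y, M ≤ |y| → deriv ψ y = 0 := fun y hy => hψM₂ y ((le_max_right _ _).trans hy)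
  simp_rw [hS.integral_test_eq h hψ hM hψM]
  have hfrac := fun i => hS.shiftedFracDeriv_integral_mul_survival h hχ (ψ 0) M ht
    (h.lam_nonneg i) (h.α_mem i).1.le (h.α_mem i).2
  have hparts := hS.integral_deriv_exitDensity_mul h ht hψ hcs hM hψM hψM'
    (hS.tendsto_exitDensity_nhdsGT_zero h ht)
  refine ⟨fun i => (hfrac i).1, hparts.1, ?_⟩
  rw [hparts.2]
  -- the equation of the survival function, integrated against `deriv ψ`
  have hH : ∫ x in Ioc 0 M, deriv ψ x * exitDensity c α lam x t =
      ∑ i, c i * (∫ x in Ioc 0 M, deriv ψ x *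
        shiftedFracDeriv (lam i) (α i) (fun r => survival c α lam x r) t) -
      (∑ i, c i * lam i ^ α i) * ∫ x in Ioc 0 M, deriv ψ x * survival c α lam x t := by
    simp_rw [← integral_const_mul]
    rw [← integral_finsetSum _ fun i _ => (hfrac i).2.1.const_mul (c i),
      ← integral_sub (integrable_finsetSum _ fun i _ => (hfrac i).2.1.const_mul (c i))
        ((hS.integrableOn_mul_survival h hχ M t).const_mul _)]
    refine setIntegral_congr_fun measurableSet_Ioc fun x hx => ?_
    rw [← hS.sum_shiftedFracDeriv_survival h hx.1 ht.le, mul_sub, Finset.mul_sum]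
    congr 1
    · exact Finset.sum_congr rfl fun i _ => by ring
    · ring
  rw [hH]
  simp_rw [fun i => (hfrac i).2.2]
  simp only [Fin.sum_univ_two]
  ring

end IsMTSS

theorem proposition3p6 {Ω : Type*} [MeasurableSpace Ω] (P : Measure Ω) [IsProbabilityMeasure P]
    (c α lam : Fin 2 → ℝ) (hc : ∀ i, 0 ≤ c i) (hc1 : ∑ i, c i = 1)
    (hα : ∀ i, α i ∈ Ioo (0 : ℝ) 1) (hlam : ∀ i, 0 ≤ lam i)
    (S : ℝ≥0 → Ω → ℝ) (hS : IsMTSS c α lam S P) :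
    ∃ H : ℝ → ℝ → ℝ,
      -- for `t > 0`, `H(·, t)` is a probability density of `E(t)` on `(0, ∞)`
      (∀ x t, 0 < x → 0 < t → 0 ≤ H x t) ∧
      (∀ t, 0 < t → HasLaw (firstExit S t)
        ((volume.restrict (Ioi 0)).withDensity (fun x => ENNReal.ofReal (H x t))) P) ∧
      -- initial condition `H(x, 0) = δ(x)`: off the origin, as law of `E(0)`, and as a weak limit
      (∀ x, 0 < x → H x 0 = 0) ∧
      HasLaw (firstExit S 0) (Measure.dirac 0) P ∧
      (∀ ψ : BoundedContinuousFunction ℝ ℝ,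
        Tendsto (fun t => ∫ x in Ioi 0, ψ x * H x t) (𝓝[>] 0) (𝓝 (ψ 0))) ∧
      -- the equation pointwise at `x > 0`, where `δ(x) = 0`
      (∀ x t, 0 < x → 0 < t →
        (∀ i, HasShiftedFracDeriv (lam i) (α i) (fun r => H x r) t) ∧
        HasDerivAt (fun y => H y t)
          (-(∑ i, c i * shiftedFracDeriv (lam i) (α i) (fun r => H x r) t)
            + (∑ i, c i * lam i ^ α i) * H x t) x) ∧
      -- the equation with its `δ(x)` terms, as an identity of distributions in `x ∈ [0, ∞)`:
      -- `⟨H(·, r), ψ⟩` is the integral of `ψ` against the law of `E(r)`, and `⟨δ, ψ⟩ = ψ 0`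
      (∀ ψ : ℝ → ℝ, ContDiff ℝ (⊤ : ℕ∞) ψ → HasCompactSupport ψ → ∀ t, 0 < t →
        (∀ i, HasShiftedFracDeriv (lam i) (α i)
          (fun r => ∫ x, ψ x ∂(P.map (firstExit S r))) t) ∧
        IntegrableOn (fun x => deriv (fun y => H y t) x * ψ x) (Ioi 0) ∧
        ∫ x in Ioi 0, deriv (fun y => H y t) x * ψ x =
          -(∑ i, c i * shiftedFracDeriv (lam i) (α i)
              (fun r => ∫ x, ψ x ∂(P.map (firstExit S r))) t)
          + (∑ i, c i * lam i ^ α i) * (∫ x, ψ x ∂(P.map (firstExit S t)))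
          - (∑ i, c i * (t ^ (-α i) * prabhakar 1 (1 - α i) (1 - α i) (-lam i * t))) * ψ 0) := by
  have h : IsMixture c α lam := ⟨hc, hc1, hα, hlam⟩
  refine ⟨exitDensity c α lam, fun x t hx _ => hS.exitDensity_nonneg h hx t,
    fun t ht => hS.hasLaw_firstExit h ht, fun x hx => hS.exitDensity_zero h hx,
    hS.hasLaw_firstExit_zero h, hS.tendsto_integral_mul_exitDensity h,
    fun x t hx ht => ⟨fun i => ?_, hS.hasDerivAt_exitDensity h hx ht.le⟩,
    fun ψ hψ hcs t ht => ?_⟩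
  · exact hasShiftedFracDeriv_bromwich h (PolyGrowth.laplaceExp_mul_inv h) hx _ (hα i).2 t
  · exact hS.integral_deriv_exitDensity_mul_eq h ht (hψ.of_le (by simp)) hcs
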